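/- Let $A$ be a unital $C^*$-algebra, $\alpha:A\to A$ a $*$-endomorphism (not assumed unital or injective), and $L:A\to A$ a transfer operator for $(A,\alpha)$, that is, a continuous linear map which is positive and satisfies $L(\alpha(a)b)=aL(b)$ for all $a,b\in A$. Let $\mathcal T(A,\alpha,L)$ be the universal unital $C^*$-algebra generated by a copy $i_A(A)$ of $A$ ($i_A$ a unital homomorphism) and an element $S$ satisfying $S\,i_A(a)=i_A(\alpha(a))S$ and $S^*i_A(a)S=i_A(L(a))$ for $a\in A$. Let $M_L$ be the Hilbert bimodule over $A$ obtained by completing (after dividing out the vectors of length zero) a copy of $A$ with right action $m\cdot a=m\alpha(a)$ and inner product $\langle m,n\rangle_L=L(m^*n)$; write $q:A\to M_L$ for the canonical map, and $\phi(a)$ for the adjointable operator on $M_L$ with $\phi(a)q(b)=q(ab)$. Let $\mathcal K(M_L)$ be the closed linear span of the operators $\Theta_{x,y}:z\mapsto x\cdot\langle y,z\rangle_L$, and put $J(M_L)=\phi^{-1}(\mathcal K(M_L))$. Let $\psi_S:M_L\to\mathcal T(A,\alpha,L)$ be the bounded linear map with $\psi_S(q(a))=i_A(a)S$, and let $(\psi_S,i_A)^{(1)}:\mathcal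 K(M_L)\to\mathcal T(A,\alpha,L)$ be the continuous linear map (in fact a homomorphism) with $(\psi_S,i_A)^{(1)}(\Theta_{x,y})=\psi_S(x)\psi_S(y)^*$ for $x,y\in M_L$. A redundancy is a pair $(i_A(a),k)$ with $a\in A$ and $k\in\overline{\operatorname{span}}\,i_A(A)SS^*i_A(A)$ such that $i_A(a)i_A(b)S=k\,i_A(b)S$ for all $b\in A$. Exel's crossed product $A\rtimes_{\alpha,L}\mathbb N$ is the quotient of $\mathcal T(A,\alpha,L)$ by the closed two-sided ideal generated by the elements $i_A(a)-k$, where $(i_A(a),k)$ is a redundancy with $a\in\overline{\operatorname{span}}\,A\alpha(A)A$. Then: (1) For $a\in A$ and $k\in\mathcal T(A,\alpha,L)$, the pair $(i_A(a),k)$ is a redundancy if and only if $a\in J(M_L)$ and $k=(\psi_S,i_A)^{(1)}(\phi(a))$. (2) Let $K_\alpha=\overline{\operatorname{span}}\,A\alpha(A)A\,\cap J(M_L)$, and let $I(A,\alpha,L)$ be the closed two-sided ideal of $\mathcal T(A,\alpha,L)$ generated by the elements $i_A(a)-(\psi_S,i_A)^{(1)}(\phi(a))$ with $a\in K_\alpha$.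 Then $A\rtimes_{\alpha,L}\mathbb N=\mathcal T(A,\alpha,L)/I(A,\alpha,L)$: the ideal defining $A\rtimes_{\alpha,L}\mathbb N$ equals $I(A,\alpha,L)$, and there is a $*$-isomorphism $A\rtimes_{\alpha,L}\mathbb N\to\mathcal T(A,\alpha,L)/I(A,\alpha,L)$ which carries the one quotient map to the other. -/

import Mathlib

noncomputable section

open UniformSpace

universe u v w

set_option linter.unusedSectionVars false

/-! ### Completing a `*`-algebra in a `C*`-seminorm -/

/-- A `C*`-seminorm on a unital complex `*`-algebra. -/
structure CStarSeminorm (F : Type u) [Ring F] [StarRing F] [Algebra ℂ F] extends Seminorm ℂ F where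
  mul_le' : ∀ x y, toFun (x * y) ≤ toFun x * toFun y
  sq_le' : ∀ x, toFun x ^ 2 ≤ toFun (star x * x)

namespace CStarSeminorm

variable {F : Type u} [Ring F] [StarRing F] [Algebra ℂ F] [StarModule ℂ F]

/-- The `*`-algebra `F`, regarded as a seminormed space with the seminorm `p`. -/
def Carrier (_p : CStarSeminorm F) : Type u := F

variable (p : CStarSeminorm F)

instance : Ring p.Carrier := inferInstanceAs (Ring F)
instance : StarRing p.Carrier := inferInstanceAs (StarRing F)
instance : Algebra ℂ p.Carrier := inferInstanceAs (Algebra ℂ F)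
instance : StarModule ℂ p.Carrier := inferInstanceAs (StarModule ℂ F)

instance : SeminormedRing p.Carrier :=
  { (inferInstance : Ring p.Carrier),
    (AddGroupSeminorm.toSeminormedAddCommGroup
      (E := p.Carrier) (Seminorm.toAddGroupSeminorm (𝕜 := ℂ) (E := F) p.toSeminorm)) with
    norm_mul_le := p.mul_le' }

/-- The identity map from `F` to `p.Carrier`. -/
def of : F → p.Carrier := id

theorem norm_of (x : F) : ‖p.of x‖ = p.toSeminorm x := rfl

instance : NormedAlgebra ℂ p.Carrier :=
  { (inferInstance : Algebra ℂ p.Carrier) with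
    norm_smul_le := fun c x => (p.toSeminorm.smul' c x).le }

theorem carrier_sq_le (x : p.Carrier) : ‖x‖ ^ 2 ≤ ‖star x * x‖ := p.sq_le' x

instance : NormedStarGroup p.Carrier where
  norm_star_le := by
    intro x
    by_cases h : ‖star x‖ = 0
    · rw [h]; exact norm_nonneg _
    · have h1 := p.carrier_sq_le (star x)
      have h2 := norm_mul_le (star (star x)) (star x)
      rw [star_star] at h1 h2
      have h3 : 0 < ‖star x‖ := lt_of_le_of_ne (norm_nonneg _) (Ne.symm h)
      nlinarith

/-- The Hausdorff completion of `F` in the seminorm `p`. -/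
abbrev Comp : Type u := Completion p.Carrier

instance : NormedAlgebra ℂ p.Comp :=
  { (inferInstance : Algebra ℂ p.Comp) with
    norm_smul_le := norm_smul_le }

/-- The canonical map of `F` into its completion. -/
def toComp : F →ₐ[ℂ] p.Comp :=
  { toFun := fun x => ((p.of x : p.Carrier) : Completion p.Carrier)
    map_one' := Completion.coe_one p.Carrier
    map_zero' := Completion.coe_zero
    map_mul' := fun x y => Completion.coe_mul (p.of x) (p.of y)
    map_add' := fun x y => Completion.coe_add (p.of x) (p.of y)
    commutes' := fun _ => rfl }

theorem toComp_def (x : F) : p.toComp x = ((p.of x : p.Carrier) : Completion p.Carrier) := rfl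

theorem norm_toComp (x : F) : ‖p.toComp x‖ = p.toSeminorm x :=
  Completion.norm_coe (p.of x)

theorem denseRange_toComp : DenseRange p.toComp := Completion.denseRange_coe (α := p.Carrier)

theorem induction {P : p.Comp → Prop} (x : p.Comp) (hc : IsClosed {x | P x})
    (h : ∀ y, P (p.toComp y)) : P x := p.denseRange_toComp.induction_on x hc h

instance : Star p.Comp := ⟨Completion.map (star : p.Carrier → p.Carrier)⟩

theorem continuous_star : Continuous (star : p.Comp → p.Comp) := Completion.continuous_map

theorem star_toComp (x : F) : star (p.toComp x) = p.toComp (star x) :=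
  Completion.map_coe (star_isometry (E := p.Carrier)).uniformContinuous (p.of x)

theorem induction₂ {P : p.Comp → p.Comp → Prop} (x y : p.Comp)
    (hc : IsClosed {x : p.Comp × p.Comp | P x.1 x.2})
    (h : ∀ x y, P (p.toComp x) (p.toComp y)) : P x y :=
  Completion.induction_on₂ x y hc h

instance : StarRing p.Comp where
  star_involutive x := by
    refine p.induction (P := fun x => star (star x) = x) x
      (isClosed_eq (p.continuous_star.comp p.continuous_star) continuous_id) fun y => ?_
    rw [star_toComp, star_toComp, star_star]
  star_mul x y := by
    refine p.induction₂ (P := fun x y => star (x * y) = star y * star x) x y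
      (isClosed_eq (p.continuous_star.comp continuous_mul) ((p.continuous_star.comp
        continuous_snd).mul (p.continuous_star.comp continuous_fst))) fun x y => ?_
    rw [← map_mul, star_toComp, star_toComp, star_toComp, star_mul, map_mul]
  star_add x y := by
    refine p.induction₂ (P := fun x y => star (x + y) = star x + star y) x y
      (isClosed_eq (p.continuous_star.comp continuous_add) ((p.continuous_star.comp
        continuous_fst).add (p.continuous_star.comp continuous_snd))) fun x y => ?_
    rw [← map_add, star_toComp, star_toComp, star_toComp, star_add, map_add]

instance : StarModule ℂ p.Comp where
  star_smul c x := by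
    refine p.induction (P := fun x => star (c • x) = star c • star x) x
      (isClosed_eq (p.continuous_star.comp (continuous_const_smul c))
        ((continuous_const_smul (star c)).comp p.continuous_star)) fun y => ?_
    rw [← map_smul, star_toComp, star_toComp, star_smul, map_smul]

instance : CStarRing p.Comp where
  norm_mul_self_le x := by
    refine p.induction (P := fun x => ‖x‖ * ‖x‖ ≤ ‖star x * x‖) x
      (isClosed_le (by fun_prop) (p.continuous_star.mul continuous_id).norm) fun y => ?_
    rw [star_toComp, ← map_mul, norm_toComp, norm_toComp, ← sq]
    exact p.sq_le' y

instance : CStarAlgebra p.Comp where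

/-- A `*`-homomorphism that is dominated by `p`, on the seminormed space. -/
def homCarrier {B : Type v} [CStarAlgebra B] (f : F →⋆ₐ[ℂ] B) : p.Carrier →⋆ₐ[ℂ] B := f

theorem continuous_homCarrier {B : Type v} [CStarAlgebra B] (f : F →⋆ₐ[ℂ] B)
    (hf : ∀ x, ‖f x‖ ≤ p.toSeminorm x) :
    Continuous ((p.homCarrier f : p.Carrier →ₐ[ℂ] B) : p.Carrier →+* B) :=
  AddMonoidHomClass.continuous_of_bound _ 1 (fun x => by rw [one_mul]; exact hf x)

/-- A `*`-homomorphism that is dominated by `p` extends to the completion. -/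
def lift {B : Type v} [CStarAlgebra B] (f : F →⋆ₐ[ℂ] B) (hf : ∀ x, ‖f x‖ ≤ p.toSeminorm x) :
    p.Comp →⋆ₐ[ℂ] B :=
  { Completion.extensionHom _ (p.continuous_homCarrier f hf) with
    commutes' := fun c => (Completion.extensionHom_coe _ (p.continuous_homCarrier f hf)
      (algebraMap ℂ p.Carrier c)).trans (AlgHomClass.commutes f c)
    map_star' := fun x => by
      have hE : Continuous (Completion.extensionHom _ (p.continuous_homCarrier f hf)) :=
        Completion.continuous_extension
      have hc := fun y => Completion.extensionHom_coe _ (p.continuous_homCarrier f hf) (p.of y)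
      change Completion.extensionHom _ (p.continuous_homCarrier f hf) (star x) =
        star (Completion.extensionHom _ (p.continuous_homCarrier f hf) x)
      refine p.induction x (isClosed_eq (hE.comp p.continuous_star) hE.star) fun y => ?_
      rw [Function.comp_apply, star_toComp]
      exact (hc (star y)).trans ((map_star f y).trans (congrArg star (hc y).symm)) }

theorem lift_toComp {B : Type v} [CStarAlgebra B] (f : F →⋆ₐ[ℂ] B)
    (hf : ∀ x, ‖f x‖ ≤ p.toSeminorm x) (x : F) : p.lift f hf (p.toComp x) = f x :=
  Completion.extensionHom_coe _ (p.continuous_homCarrier f hf) (p.of x)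

end CStarSeminorm

/-! ### The free unital `*`-algebra on a set with involution -/

/-- The free complex algebra on a set `G`; when `G` carries an involution, it is a `*`-algebra
whose `*` extends that involution conjugate-linearly and antimultiplicatively. -/
def FreeStarAlg (G : Type u) : Type u := FreeAlgebra ℂ G

namespace FreeStarAlg

variable {G : Type u}

instance : Ring (FreeStarAlg G) := inferInstanceAs (Ring (FreeAlgebra ℂ G))
instance : Algebra ℂ (FreeStarAlg G) := inferInstanceAs (Algebra ℂ (FreeAlgebra ℂ G))

/-- The generator attached to an element of `G`. -/
def gen (g : G) : FreeStarAlg G := FreeAlgebra.ι ℂ g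

/-- The algebra homomorphism given by prescribed values on the generators. -/
def eval {B : Type v} [Ring B] [Algebra ℂ B] (f : G → B) : FreeStarAlg G →ₐ[ℂ] B :=
  FreeAlgebra.lift ℂ f

@[simp] theorem eval_gen {B : Type v} [Ring B] [Algebra ℂ B] (f : G → B) (g : G) :
    eval f (gen g) = f g := FreeAlgebra.lift_ι_apply f g

theorem induct {P : FreeStarAlg G → Prop} (hs : ∀ c : ℂ, P (algebraMap ℂ _ c))
    (hg : ∀ g, P (gen g)) (hm : ∀ x y, P x → P y → P (x * y))
    (ha : ∀ x y, P x → P y → P (x + y)) (x : FreeStarAlg G) : P x :=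
  FreeAlgebra.induction ℂ G hs hg hm ha x

/-- The opposite algebra with conjugate scalar multiplication. -/
def ConjOp (G : Type u) : Type u := (FreeStarAlg G)ᵐᵒᵖ

instance : Ring (ConjOp G) := inferInstanceAs (Ring (FreeStarAlg G)ᵐᵒᵖ)
instance : Algebra ℂ (ConjOp G) :=
  ((algebraMap ℂ (FreeStarAlg G)ᵐᵒᵖ).comp (starRingEnd ℂ)).toAlgebra'
    (fun c x => Algebra.commutes (A := (FreeStarAlg G)ᵐᵒᵖ) (starRingEnd ℂ c) x)

variable [InvolutiveStar G]

/-- The `*`-operation, as a homomorphism into the conjugate opposite algebra. -/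
def starHom : FreeStarAlg G →ₐ[ℂ] ConjOp G := 
  eval (B := ConjOp G) fun g => (MulOpposite.op (gen (star g)) : (FreeStarAlg G)ᵐᵒᵖ)

instance : Star (FreeStarAlg G) := ⟨fun x => MulOpposite.unop (starHom x : (FreeStarAlg G)ᵐᵒᵖ)⟩

theorem star_def (x : FreeStarAlg G) :
    star x = MulOpposite.unop (starHom x : (FreeStarAlg G)ᵐᵒᵖ) := rfl

@[simp] theorem star_gen (g : G) : star (gen g) = gen (star g) := by
  exact congrArg MulOpposite.unop
    (eval_gen (B := ConjOp G) (fun g => (MulOpposite.op (gen (star g)) : (FreeStarAlg G)ᵐᵒᵖ)) g)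

theorem star_algebraMap' (c : ℂ) :
    star (algebraMap ℂ (FreeStarAlg G) c) = algebraMap ℂ _ (star c) := by
  rw [star_def, AlgHom.commutes]; rfl

theorem star_add' (x y : FreeStarAlg G) : star (x + y) = star x + star y := by
  rw [star_def, map_add]; rfl

theorem star_mul' (x y : FreeStarAlg G) : star (x * y) = star y * star x := by
  rw [star_def, map_mul]; rfl

instance : StarRing (FreeStarAlg G) where
  star_involutive x := by
    induction x using induct with
    | hs c => rw [star_algebraMap', star_algebraMap', star_star]
    | hg g => rw [star_gen, star_gen, star_star]
    | hm x y hx hy => rw [star_mul', star_mul', hx, hy]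
    | ha x y hx hy => rw [star_add', star_add', hx, hy]
  star_mul := star_mul'
  star_add := star_add'

instance : StarModule ℂ (FreeStarAlg G) where
  star_smul c x := by
    rw [Algebra.smul_def, star_mul, star_algebraMap', ← Algebra.commutes, ← Algebra.smul_def]

/-- The `*`-homomorphism given by prescribed values on the generators. -/
def evalStar {B : Type v} [Ring B] [StarRing B] [Algebra ℂ B] [StarModule ℂ B] (f : G → B)
    (hf : ∀ g, f (star g) = star (f g)) : FreeStarAlg G →⋆ₐ[ℂ] B :=
  { eval f with
    map_star' := fun x => by
      change eval f (star x) = star (eval f x)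
      induction x using induct with
      | hs c => rw [star_algebraMap', AlgHom.commutes, AlgHom.commutes, algebraMap_star_comm]
      | hg g => rw [star_gen, eval_gen, eval_gen, hf]
      | hm x y hx hy => rw [star_mul, map_mul, map_mul, hx, hy, star_mul]
      | ha x y hx hy => rw [star_add, map_add, map_add, hx, hy, star_add] }

@[simp] theorem evalStar_gen {B : Type v} [Ring B] [StarRing B] [Algebra ℂ B] [StarModule ℂ B]
    (f : G → B) (hf : ∀ g, f (star g) = star (f g)) (g : G) : evalStar f hf (gen g) = f g :=
  eval_gen f g

end FreeStarAlg

/-! ### Transfer operators and the Toeplitz algebra -/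

section Toeplitz

variable {A : Type u} [CStarAlgebra A] [PartialOrder A] [StarOrderedRing A]

/-- A transfer operator for `(A, α)`: a continuous linear map `L : A → A` that is positive and
satisfies `L (α(a) b) = a L(b)`. The endomorphism `α` is not assumed unital or injective. -/
structure TransferOperator (α : A →⋆ₙₐ[ℂ] A) where
  toCLM : A →L[ℂ] A
  nonneg' : ∀ a, 0 ≤ a → 0 ≤ toCLM a
  map_mul' : ∀ a b, toCLM (α a * b) = a * toCLM b

variable {α : A →⋆ₙₐ[ℂ] A}

instance : CoeFun (TransferOperator α) fun _ => A → A := ⟨fun L => L.toCLM⟩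

/-- A Toeplitz-covariant representation of `(A, α, L)` in a unital `C*`-algebra `B`: a unital
homomorphism `ρ : A → B` and an element `V` of `B` with `V ρ(a) = ρ(α(a)) V` and
`V* ρ(a) V = ρ(L(a))`. -/
structure ToeplitzCovariantRep (L : TransferOperator α) (B : Type v) [CStarAlgebra B] where
  ρ : A →⋆ₐ[ℂ] B
  V : B
  comm : ∀ a, V * ρ a = ρ (α a) * V
  conj : ∀ a, star V * ρ a * V = ρ (L a)

/-- Generators: a copy of `A`, the element `S` and its adjoint. -/
inductive ToeplitzGen (A : Type u) : Type u
  | elt : A → ToeplitzGen A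
  | S : ToeplitzGen A
  | Sstar : ToeplitzGen A

/-- The involution on the generators. -/
def ToeplitzGen.adj : ToeplitzGen A → ToeplitzGen A
  | .elt a => .elt (star a)
  | .S => .Sstar
  | .Sstar => .S

instance : InvolutiveStar (ToeplitzGen A) where
  star := ToeplitzGen.adj
  star_involutive g := by
    cases g with
    | elt a => exact congrArg ToeplitzGen.elt (star_star a)
    | S => rfl
    | Sstar => rfl

variable {L : TransferOperator α}

namespace ToeplitzCovariantRep

variable {B : Type v} [CStarAlgebra B]

/-- The values of a representation on the generators. -/
def onGen (r : ToeplitzCovariantRep L B) : ToeplitzGen A → B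
  | .elt a => r.ρ a
  | .S => r.V
  | .Sstar => star r.V

/-- The `*`-homomorphism of the free `*`-algebra determined by a representation. -/
def eval (r : ToeplitzCovariantRep L B) : FreeStarAlg (ToeplitzGen A) →⋆ₐ[ℂ] B :=
  FreeStarAlg.evalStar r.onGen fun g => by
    cases g with
    | elt a => exact map_star r.ρ a
    | S => rfl
    | Sstar => exact (star_star r.V).symm

theorem eval_gen (r : ToeplitzCovariantRep L B) (g : ToeplitzGen A) :
    r.eval (FreeStarAlg.gen g) = r.onGen g := FreeStarAlg.evalStar_gen _ _ g

theorem norm_V_le (r : ToeplitzCovariantRep L B) : ‖r.V‖ ≤ 1 + ‖L 1‖ := by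
  have h1 : ‖r.V‖ * ‖r.V‖ ≤ ‖L 1‖ := by
    rw [← CStarRing.norm_star_mul_self (x := r.V)]
    have h := r.conj 1
    rw [map_one, mul_one] at h
    rw [h]
    exact NonUnitalStarAlgHom.norm_apply_le r.ρ _
  nlinarith [norm_nonneg r.V, norm_nonneg (L 1)]

end ToeplitzCovariantRep

variable (L)

theorem exists_norm_eval_le (x : FreeStarAlg (ToeplitzGen A)) :
    ∃ C, ∀ (B : Type v) [CStarAlgebra B] (r : ToeplitzCovariantRep L B), ‖r.eval x‖ ≤ C := by
  induction x using FreeStarAlg.induct with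
  | hs c =>
    refine ⟨‖c‖, fun B _ r => ?_⟩
    rw [AlgHomClass.commutes, norm_algebraMap]
    have : ‖(1 : B)‖ ≤ 1 := by
      rcases subsingleton_or_nontrivial B with h | h
      · rw [Subsingleton.elim (1 : B) 0, norm_zero]; exact zero_le_one
      · exact CStarRing.norm_one.le
    nlinarith [norm_nonneg c]
  | hg g =>
    cases g with
    | elt a => exact ⟨‖a‖, fun B _ r => by
        rw [r.eval_gen]; exact NonUnitalStarAlgHom.norm_apply_le r.ρ _⟩
    | S => exact ⟨1 + ‖L 1‖, fun B _ r => by rw [r.eval_gen]; exact r.norm_V_le⟩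
    | Sstar => exact ⟨1 + ‖L 1‖, fun B _ r => by
        rw [r.eval_gen]; exact (norm_star r.V).trans_le r.norm_V_le⟩
  | hm x y hx hy =>
    obtain ⟨C, hC⟩ := hx
    obtain ⟨D, hD⟩ := hy
    refine ⟨C * D, fun B _ r => ?_⟩
    rw [map_mul]
    exact (norm_mul_le _ _).trans
      (mul_le_mul (hC B r) (hD B r) (norm_nonneg _) ((norm_nonneg _).trans (hC B r)))
  | ha x y hx hy =>
    obtain ⟨C, hC⟩ := hx
    obtain ⟨D, hD⟩ := hy
    refine ⟨C + D, fun B _ r => ?_⟩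
    rw [map_add]
    exact (norm_add_le _ _).trans (add_le_add (hC B r) (hD B r))

/-- The norms of the images of `x` under all Toeplitz-covariant representations. -/
def repNorms (x : FreeStarAlg (ToeplitzGen A)) : Set ℝ :=
  {t | ∃ (B : Type u) (_ : CStarAlgebra B) (r : ToeplitzCovariantRep L B), t = ‖r.eval x‖}

variable {L}

theorem norm_eval_le_sSup {B : Type u} [CStarAlgebra B] (r : ToeplitzCovariantRep L B)
    (x : FreeStarAlg (ToeplitzGen A)) : ‖r.eval x‖ ≤ sSup (repNorms L x) := by
  refine le_csSup ?_ ⟨B, _, r, rfl⟩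
  obtain ⟨C, hC⟩ := exists_norm_eval_le.{u, u} L x
  refine ⟨C, ?_⟩
  rintro t ⟨B, _, r, rfl⟩
  exact hC B r

theorem sSup_repNorms_le {x : FreeStarAlg (ToeplitzGen A)} {c : ℝ} (hc : 0 ≤ c)
    (h : ∀ (B : Type u) [CStarAlgebra B] (r : ToeplitzCovariantRep L B), ‖r.eval x‖ ≤ c) :
    sSup (repNorms L x) ≤ c :=
  Real.sSup_le (by rintro t ⟨B, _, r, rfl⟩; exact h B r) hc

theorem sSup_repNorms_nonneg (x : FreeStarAlg (ToeplitzGen A)) : 0 ≤ sSup (repNorms L x) :=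
  Real.sSup_nonneg (by rintro t ⟨B, _, r, rfl⟩; exact norm_nonneg _)

variable (L)

/-- The universal `C*`-seminorm: the supremum of `‖r.eval x‖` over all Toeplitz-covariant
representations `r` of `(A, α, L)`. -/
def toeplitzSeminorm : CStarSeminorm (FreeStarAlg (ToeplitzGen A)) :=
  { Seminorm.ofSMulLE (𝕜 := ℂ) (fun x => sSup (repNorms L x))
      (le_antisymm (sSup_repNorms_le le_rfl fun B _ r => by simp) (sSup_repNorms_nonneg 0))
      (fun x y => sSup_repNorms_le (add_nonneg (sSup_repNorms_nonneg x) (sSup_repNorms_nonneg y))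
        fun B _ r => by
          rw [map_add]
          exact (norm_add_le _ _).trans
            (add_le_add (norm_eval_le_sSup r x) (norm_eval_le_sSup r y)))
      (fun c x => sSup_repNorms_le (mul_nonneg (norm_nonneg c) (sSup_repNorms_nonneg x))
        fun B _ r => by
          rw [map_smul, norm_smul]
          exact mul_le_mul_of_nonneg_left (norm_eval_le_sSup r x) (norm_nonneg c)) with
    mul_le' := fun x y =>
      sSup_repNorms_le (mul_nonneg (sSup_repNorms_nonneg x) (sSup_repNorms_nonneg y))
        fun B _ r => by
          rw [map_mul]
          exact (norm_mul_le _ _).trans (mul_le_mul (norm_eval_le_sSup r x)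
            (norm_eval_le_sSup r y) (norm_nonneg _) (sSup_repNorms_nonneg x))
    sq_le' := fun x => by
      change sSup (repNorms L x) ^ 2 ≤ sSup (repNorms L (star x * x))
      rw [← Real.le_sqrt (sSup_repNorms_nonneg _) (sSup_repNorms_nonneg _)]
      refine sSup_repNorms_le (Real.sqrt_nonneg _) fun B _ r => Real.le_sqrt_of_sq_le ?_
      rw [sq, ← CStarRing.norm_star_mul_self, ← map_star, ← map_mul]
      exact norm_eval_le_sSup r _ }

/-- The Toeplitz algebra `𝒯(A, α, L)`: the universal unital `C*`-algebra generated by a copy of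
`A` and an element `S` subject to `S a = α(a) S` and `S* a S = L(a)`. -/
def ToeplitzAlgebra : Type u := (toeplitzSeminorm L).Comp

instance : CStarAlgebra (ToeplitzAlgebra L) :=
  inferInstanceAs (CStarAlgebra (toeplitzSeminorm L).Comp)

namespace ToeplitzAlgebra

/-- The canonical map from the free `*`-algebra on the generators. -/
def ofFree : FreeStarAlg (ToeplitzGen A) →⋆ₐ[ℂ] ToeplitzAlgebra L :=
  { (toeplitzSeminorm L).toComp with
    map_star' := fun x => ((toeplitzSeminorm L).star_toComp x).symm }

theorem norm_ofFree (x : FreeStarAlg (ToeplitzGen A)) :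
    ‖ofFree L x‖ = sSup (repNorms L x) := (toeplitzSeminorm L).norm_toComp x

theorem denseRange_ofFree : DenseRange (ofFree L) := (toeplitzSeminorm L).denseRange_toComp

theorem ofFree_eq {x y : FreeStarAlg (ToeplitzGen A)}
    (h : ∀ (B : Type u) [CStarAlgebra B] (r : ToeplitzCovariantRep L B), r.eval x = r.eval y) :
    ofFree L x = ofFree L y := by
  rw [← sub_eq_zero, ← map_sub, ← norm_le_zero_iff, norm_ofFree]
  refine sSup_repNorms_le le_rfl fun B _ r => ?_
  rw [map_sub, h, sub_self, norm_zero]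

/-- The canonical unital homomorphism `i_A : A → 𝒯(A, α, L)`. -/
def iA : A →⋆ₐ[ℂ] ToeplitzAlgebra L where
  toFun a := ofFree L (.gen (.elt a))
  map_one' := by
    rw [← map_one (ofFree L)]
    exact ofFree_eq L fun B _ r => by rw [r.eval_gen, map_one]; exact map_one r.ρ
  map_mul' a b := by
    rw [← map_mul]
    exact ofFree_eq L fun B _ r => by
      rw [map_mul, r.eval_gen, r.eval_gen, r.eval_gen]; exact map_mul r.ρ a b
  map_zero' := by
    rw [← map_zero (ofFree L)]
    exact ofFree_eq L fun B _ r => by rw [r.eval_gen, map_zero]; exact map_zero r.ρ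
  map_add' a b := by
    rw [← map_add]
    exact ofFree_eq L fun B _ r => by
      rw [map_add, r.eval_gen, r.eval_gen, r.eval_gen]; exact map_add r.ρ a b
  commutes' c := by
    rw [← AlgHomClass.commutes (ofFree L)]
    exact ofFree_eq L fun B _ r => by
      rw [r.eval_gen, AlgHomClass.commutes]; exact AlgHomClass.commutes r.ρ c
  map_star' a := by
    rw [← map_star]
    exact ofFree_eq L fun B _ r => by
      rw [map_star, r.eval_gen, r.eval_gen]; exact map_star r.ρ a

/-- The canonical element `S` of `𝒯(A, α, L)`. -/
def S : ToeplitzAlgebra L := ofFree L (.gen .S)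

theorem star_S : star (S L) = ofFree L (.gen .Sstar) := by
  rw [S, ← map_star, FreeStarAlg.star_gen]; rfl

theorem S_mul_iA (a : A) : S L * iA L a = iA L (α a) * S L := by
  change ofFree L _ * ofFree L _ = ofFree L _ * ofFree L _
  rw [← map_mul, ← map_mul]
  exact ofFree_eq L fun B _ r => by
    rw [map_mul, map_mul, r.eval_gen, r.eval_gen, r.eval_gen]; exact r.comm a

theorem star_S_mul_iA_mul_S (a : A) : star (S L) * iA L a * S L = iA L (L a) := by
  rw [star_S]
  change ofFree L _ * ofFree L _ * ofFree L _ = ofFree L _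
  rw [← map_mul, ← map_mul]
  exact ofFree_eq L fun B _ r => by
    rw [map_mul, map_mul, r.eval_gen, r.eval_gen, r.eval_gen, r.eval_gen]; exact r.conj a

/-- The universal Toeplitz-covariant representation `(i_A, S)`. -/
def universalRep : ToeplitzCovariantRep L (ToeplitzAlgebra L) where
  ρ := iA L
  V := S L
  comm := S_mul_iA L
  conj := star_S_mul_iA_mul_S L

variable {L}

/-- The `C*`-seminorm defined by a single representation. -/
def repSeminorm {B : Type v} [CStarAlgebra B] (r : ToeplitzCovariantRep L B) :
    CStarSeminorm (FreeStarAlg (ToeplitzGen A)) :=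
  { Seminorm.ofSMulLE (𝕜 := ℂ) (fun x => ‖r.eval x‖) (by simp)
      (fun x y => by rw [map_add]; exact norm_add_le _ _)
      (fun c x => by rw [map_smul, norm_smul]) with
    mul_le' := fun x y => by
      change ‖r.eval (x * y)‖ ≤ ‖r.eval x‖ * ‖r.eval y‖
      rw [map_mul]; exact norm_mul_le _ _
    sq_le' := fun x => by
      change ‖r.eval x‖ ^ 2 ≤ ‖r.eval (star x * x)‖
      rw [map_mul, map_star, CStarRing.norm_star_mul_self, sq] }

theorem repSeminorm_eq {B : Type v} [CStarAlgebra B] (r : ToeplitzCovariantRep L B)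
    {x y : FreeStarAlg (ToeplitzGen A)} (h : r.eval x = r.eval y) :
    (repSeminorm r).toComp x = (repSeminorm r).toComp y := by
  rw [← sub_eq_zero, ← map_sub, ← norm_le_zero_iff, CStarSeminorm.norm_toComp]
  change ‖r.eval (x - y)‖ ≤ 0
  rw [map_sub, h, sub_self, norm_zero]

/-- A copy, in the universe of `A`, of a representation in any universe. -/
def smallRep {B : Type v} [CStarAlgebra B] (r : ToeplitzCovariantRep L B) :
    ToeplitzCovariantRep L (repSeminorm r).Comp where
  ρ :=
    { toFun := fun a => (repSeminorm r).toComp (.gen (.elt a))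
      map_one' := by
        rw [← map_one (repSeminorm r).toComp]
        exact repSeminorm_eq r (by rw [r.eval_gen, map_one]; exact map_one r.ρ)
      map_mul' := fun a b => by
        rw [← map_mul]
        exact repSeminorm_eq r (by
          rw [map_mul, r.eval_gen, r.eval_gen, r.eval_gen]; exact map_mul r.ρ a b)
      map_zero' := by
        rw [← map_zero (repSeminorm r).toComp]
        exact repSeminorm_eq r (by rw [r.eval_gen, map_zero]; exact map_zero r.ρ)
      map_add' := fun a b => by
        rw [← map_add]
        exact repSeminorm_eq r (by
          rw [map_add, r.eval_gen, r.eval_gen, r.eval_gen]; exact map_add r.ρ a b)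
      commutes' := fun c => by
        rw [← AlgHomClass.commutes (repSeminorm r).toComp]
        exact repSeminorm_eq r (by
          rw [r.eval_gen, AlgHomClass.commutes]; exact AlgHomClass.commutes r.ρ c)
      map_star' := fun a => by
        rw [CStarSeminorm.star_toComp]
        exact repSeminorm_eq r (by
          rw [map_star, r.eval_gen, r.eval_gen]; exact map_star r.ρ a) }
  V := (repSeminorm r).toComp (.gen .S)
  comm a := by
    change (repSeminorm r).toComp _ * (repSeminorm r).toComp _ =
      (repSeminorm r).toComp _ * (repSeminorm r).toComp _
    rw [← map_mul, ← map_mul]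
    exact repSeminorm_eq r (by
      rw [map_mul, map_mul, r.eval_gen, r.eval_gen, r.eval_gen]; exact r.comm a)
  conj a := by
    change star ((repSeminorm r).toComp _) * (repSeminorm r).toComp _ *
      (repSeminorm r).toComp _ = (repSeminorm r).toComp _
    rw [CStarSeminorm.star_toComp, ← map_mul, ← map_mul]
    exact repSeminorm_eq r (by
      rw [map_mul, map_mul, map_star, r.eval_gen, r.eval_gen, r.eval_gen]; exact r.conj a)

theorem norm_eval_le {B : Type v} [CStarAlgebra B] (r : ToeplitzCovariantRep L B)
    (x : FreeStarAlg (ToeplitzGen A)) : ‖r.eval x‖ ≤ sSup (repNorms L x) := by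
  have h : ∀ y, (smallRep r).eval y = (repSeminorm r).toComp y := by
    intro y
    induction y using FreeStarAlg.induct with
    | hs c => rw [AlgHomClass.commutes, AlgHomClass.commutes]
    | hg g =>
      rw [ToeplitzCovariantRep.eval_gen]
      cases g with
      | elt a => rfl
      | S => rfl
      | Sstar =>
        change star ((repSeminorm r).toComp _) = _
        rw [CStarSeminorm.star_toComp, FreeStarAlg.star_gen]; rfl
    | hm x y hx hy => rw [map_mul, map_mul, hx, hy]
    | ha x y hx hy => rw [map_add, map_add, hx, hy]
  have h2 := norm_eval_le_sSup (smallRep r) x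
  rw [h, CStarSeminorm.norm_toComp] at h2
  exact h2

/-- The universal property of `𝒯(A, α, L)`: the homomorphism `ρ × V`. -/
def lift {B : Type v} [CStarAlgebra B] (r : ToeplitzCovariantRep L B) :
    ToeplitzAlgebra L →⋆ₐ[ℂ] B := (toeplitzSeminorm L).lift r.eval (norm_eval_le r)

theorem lift_ofFree {B : Type v} [CStarAlgebra B] (r : ToeplitzCovariantRep L B)
    (x : FreeStarAlg (ToeplitzGen A)) : lift r (ofFree L x) = r.eval x :=
  (toeplitzSeminorm L).lift_toComp r.eval (norm_eval_le r) x

theorem lift_iA {B : Type v} [CStarAlgebra B] (r : ToeplitzCovariantRep L B) (a : A) :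
    lift r (iA L a) = r.ρ a := (lift_ofFree r _).trans (r.eval_gen _)

theorem lift_S {B : Type v} [CStarAlgebra B] (r : ToeplitzCovariantRep L B) :
    lift r (S L) = r.V := (lift_ofFree r _).trans (r.eval_gen _)

end ToeplitzAlgebra

end Toeplitz

/-! ### Hilbert bimodules, compact operators and Toeplitz representations -/

section HilbertBimodule

open MulOpposite

theorem cauchySchwarz_aux {A : Type u} [CStarAlgebra A] [PartialOrder A] [StarOrderedRing A]
    {p q r : A} (hq : 0 ≤ q) (h : ∀ (a : A) (t : ℝ),
      0 ≤ star a * q * a - t • (star a * r) - t • (star r * a) + t • t • p) :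
    ‖r‖ ^ 2 ≤ ‖q‖ * ‖p‖ := by
  have key : ∀ t : ℝ, ‖q‖ < t → ‖r‖ ^ 2 ≤ t * ‖p‖ := by
    intro t ht
    have ht0 : 0 < t := (norm_nonneg q).trans_lt ht
    have h1 : star r * q * r ≤ t • (star r * r) :=
      (CStarAlgebra.star_left_conjugate_le_norm_smul (IsSelfAdjoint.of_nonneg hq)).trans
        (smul_le_smul_of_nonneg_right ht.le (star_mul_self_nonneg r))
    have h2 : t • (star r * r) ≤ t • t • p := by
      have h3 := h r t
      rw [← sub_nonneg]
      refine h3.trans ?_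
      rw [← sub_nonneg]
      have h4 := sub_nonneg.mpr h1
      convert h4 using 1
      abel
    have h5 : star r * r ≤ t • p := (smul_le_smul_iff_of_pos_left ht0).mp h2
    calc ‖r‖ ^ 2 = ‖star r * r‖ := by rw [CStarRing.norm_star_mul_self, sq]
      _ ≤ ‖t • p‖ := CStarAlgebra.norm_le_norm_of_nonneg_of_le (star_mul_self_nonneg r) h5
      _ = t * ‖p‖ := by rw [norm_smul, Real.norm_of_nonneg ht0.le]
  refine le_of_forall_gt_imp_ge_of_dense fun c hc => ?_
  by_cases hp : ‖p‖ = 0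
  · have := key (‖q‖ + 1) (by linarith)
    rw [hp, mul_zero] at this hc
    linarith
  · have hp' : 0 < ‖p‖ := lt_of_le_of_ne (norm_nonneg p) (Ne.symm hp)
    have := key (c / ‖p‖) ((lt_div_iff₀ hp').mpr hc)
    rwa [div_mul_cancel₀ _ hp] at this

/-- A Hilbert bimodule over `A`: a right Hilbert `A`-module `X` (the right action is the action of
`Aᵐᵒᵖ`, the `A`-valued inner product `ip` is linear in the second variable), with a left action of
`A` by adjointable operators, given by the homomorphism `φ`. Completeness of `X` is a separate
assumption. -/
class HilbertBimodule (A : Type u) (X : Type v) [CStarAlgebra A] [PartialOrder A]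
    [NormedAddCommGroup X] [NormedSpace ℂ X] [Module Aᵐᵒᵖ X] where
  ip : X → X → A
  ip_add_right : ∀ x y z, ip x (y + z) = ip x y + ip x z
  ip_smul_right : ∀ (c : ℂ) x y, ip x (c • y) = c • ip x y
  ip_op_smul_right : ∀ (a : A) x y, ip x (op a • y) = ip x y * a
  star_ip : ∀ x y, star (ip x y) = ip y x
  ip_self_nonneg : ∀ x, 0 ≤ ip x x
  norm_sq_eq : ∀ x, ‖x‖ ^ 2 = ‖ip x x‖
  φ : A →ₙₐ[ℂ] (X →L[ℂ] X)
  ip_φ_left : ∀ a x y, ip (φ a x) y = ip x (φ (star a) y)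

namespace HilbertBimodule

variable {A : Type u} [CStarAlgebra A] [PartialOrder A] [StarOrderedRing A]
  {X : Type v} [NormedAddCommGroup X] [NormedSpace ℂ X] [Module Aᵐᵒᵖ X] [IsScalarTower ℂ Aᵐᵒᵖ X]
  [HilbertBimodule A X]

theorem ip_add_left (x y z : X) : (ip (x + y) z : A) = (ip x z : A) + (ip y z : A) := by
  rw [← star_ip, ip_add_right, star_add, star_ip, star_ip]

theorem ip_smul_left (c : ℂ) (x y : X) : (ip (c • x) y : A) = star c • (ip x y : A) := by
  rw [← star_ip, ip_smul_right, star_smul, star_ip]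

theorem ip_op_smul_left (a : A) (x y : X) : (ip (op a • x) y : A) = star a * (ip x y : A) := by
  rw [← star_ip, ip_op_smul_right, star_mul, star_ip]

theorem ip_zero_left (x : X) : (ip 0 x : A) = 0 := by
  have := ip_smul_left (A := A) 0 0 x
  simpa using this

theorem ip_zero_right (x : X) : (ip x 0 : A) = 0 := by
  have := ip_smul_right (A := A) 0 x 0
  simpa using this

theorem ip_sub_right (x y z : X) : (ip x (y - z) : A) = (ip x y : A) - (ip x z : A) := by
  have : y - z = y + (-1 : ℂ) • z := by rw [neg_one_smul, sub_eq_add_neg]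
  rw [this, ip_add_right, ip_smul_right, neg_one_smul, sub_eq_add_neg]

theorem ip_sub_left (x y z : X) : (ip (x - y) z : A) = (ip x z : A) - (ip y z : A) := by
  rw [← star_ip, ip_sub_right, star_sub, star_ip, star_ip]

theorem norm_ip_le (x y : X) : ‖(ip x y : A)‖ ≤ ‖x‖ * ‖y‖ := by
  have h : ‖(ip x y : A)‖ ^ 2 ≤ ‖(ip x x : A)‖ * ‖(ip y y : A)‖ := by
    refine cauchySchwarz_aux (ip_self_nonneg x) fun a t => ?_
    have := ip_self_nonneg (A := A) (op a • x - (t : ℂ) • y)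
    convert this using 1
    simp only [ip_sub_left, ip_sub_right, ip_smul_left, ip_smul_right, ip_op_smul_left,
      ip_op_smul_right, star_ip, Complex.star_def, Complex.conj_ofReal, mul_assoc, sub_mul,
      smul_mul_assoc]
    simp only [Complex.coe_smul, smul_sub]
    abel
  rw [← norm_sq_eq, ← norm_sq_eq, ← mul_pow] at h
  exact (pow_le_pow_iff_left₀ (norm_nonneg _) (by positivity) two_ne_zero).mp h

theorem norm_op_smul_le (a : A) (x : X) : ‖op a • x‖ ≤ ‖x‖ * ‖a‖ := by
  have h : ‖op a • x‖ ^ 2 ≤ (‖x‖ * ‖a‖) ^ 2 := by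
    rw [norm_sq_eq (A := A), ip_op_smul_right, ip_op_smul_left]
    calc ‖star a * (ip x x : A) * a‖ ≤ ‖star a‖ * ‖(ip x x : A)‖ * ‖a‖ := norm_mul₃_le
      _ = (‖x‖ * ‖a‖) ^ 2 := by rw [norm_star, ← norm_sq_eq]; ring
  exact (pow_le_pow_iff_left₀ (norm_nonneg _) (by positivity) two_ne_zero).mp h

variable (A) in
/-- The rank-one operator `Θ_{x,y} : z ↦ x · ⟨y, z⟩`. -/
def Θ (x y : X) : X →L[ℂ] X :=
  LinearMap.mkContinuous
    { toFun := fun z => op (ip y z : A) • x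
      map_add' := fun z w => by rw [ip_add_right, op_add, add_smul]
      map_smul' := fun c z => by
        rw [ip_smul_right, op_smul, smul_assoc, RingHom.id_apply] }
    (‖x‖ * ‖y‖) fun z => by
      refine (norm_op_smul_le _ x).trans ?_
      rw [mul_assoc]
      exact mul_le_mul_of_nonneg_left (norm_ip_le y z) (norm_nonneg x)

theorem Θ_apply (x y z : X) : Θ A x y z = op (ip y z : A) • x := rfl

variable (A X) in
/-- The compact operators `𝒦(X)`: the closed linear span of the rank-one operators. -/
def compacts : Submodule ℂ (X →L[ℂ] X) :=
  (Submodule.span ℂ {T | ∃ x y : X, T = Θ A x y}).topologicalClosure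

theorem Θ_mem_compacts (x y : X) : Θ A x y ∈ compacts A X :=
  Submodule.le_topologicalClosure _ (Submodule.subset_span ⟨x, y, rfl⟩)

variable (A X) in
/-- `J(X) = φ⁻¹(𝒦(X))`. -/
def J : Set A := {a | (φ a : X →L[ℂ] X) ∈ compacts A X}

variable (A X) in
/-- Formal linear combinations of rank-one operators, as compact operators. -/
def toCompacts : (X × X →₀ ℂ) →ₗ[ℂ] compacts A X :=
  Finsupp.linearCombination ℂ fun p => (⟨Θ A p.1 p.2, Θ_mem_compacts p.1 p.2⟩ : compacts A X)

theorem toCompacts_single (x y : X) (c : ℂ) :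
    (toCompacts A X (Finsupp.single (x, y) c) : X →L[ℂ] X) = c • Θ A x y := by
  rw [toCompacts, Finsupp.linearCombination_single]; rfl

theorem denseRange_toCompacts : DenseRange (toCompacts A X) := by
  intro t
  rw [closure_subtype]
  refine closure_mono ?_ t.2
  intro s hs
  have h : Submodule.span ℂ {T | ∃ x y : X, T = Θ A x y} ≤
      Submodule.map (compacts A X).subtype (LinearMap.range (toCompacts A X)) := by
    refine Submodule.span_le.mpr ?_
    rintro _ ⟨x, y, rfl⟩
    refine ⟨_, ⟨Finsupp.single (x, y) 1, rfl⟩, ?_⟩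
    rw [Submodule.subtype_apply, toCompacts_single, one_smul]
  obtain ⟨s', ⟨v, rfl⟩, rfl⟩ := h hs
  exact ⟨_, ⟨v, rfl⟩, rfl⟩

theorem exists_adjoint (v : X × X →₀ ℂ) : ∃ v' : X × X →₀ ℂ,
    (∀ x y : X, (ip ((toCompacts A X v' : X →L[ℂ] X) x) y : A) =
      (ip x ((toCompacts A X v : X →L[ℂ] X) y) : A)) ∧
    ∀ (B : Type w) [CStarAlgebra B] (ψ : X →ₗ[ℂ] B),
      Finsupp.linearCombination ℂ (fun p : X × X => ψ p.1 * star (ψ p.2)) v' =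
        star (Finsupp.linearCombination ℂ (fun p : X × X => ψ p.1 * star (ψ p.2)) v) := by
  induction v using Finsupp.induction_linear with
  | zero =>
    refine ⟨0, fun x y => ?_, fun B _ ψ => by simp⟩
    simp [ip_zero_left, ip_zero_right]
  | add f g hf hg =>
    obtain ⟨f', hf1, hf2⟩ := hf
    obtain ⟨g', hg1, hg2⟩ := hg
    refine ⟨f' + g', fun x y => ?_, fun B _ ψ => ?_⟩
    · simp only [map_add, Submodule.coe_add, add_apply, ip_add_left, ip_add_right,
        hf1, hg1]
    · rw [map_add, map_add, star_add, hf2, hg2]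
  | single p c =>
    obtain ⟨x, y⟩ := p
    refine ⟨Finsupp.single (y, x) (star c), fun z w => ?_, fun B _ ψ => ?_⟩
    · rw [toCompacts_single, toCompacts_single]
      simp only [smul_apply, Θ_apply, ip_smul_left, ip_smul_right, star_star,
        ip_op_smul_left, ip_op_smul_right, star_ip]
    · simp [Finsupp.linearCombination_single]

theorem opNorm_adjoint_le {s t : X →L[ℂ] X} (h : ∀ x y : X, (ip (s x) y : A) = (ip x (t y) : A)) :
    ‖s‖ ≤ ‖t‖ := by
  refine s.opNorm_le_bound (norm_nonneg t) fun x => ?_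
  by_cases h0 : ‖s x‖ = 0
  · rw [h0]; positivity
  · have h1 : ‖s x‖ ^ 2 ≤ ‖x‖ * (‖t‖ * ‖s x‖) := by
      rw [norm_sq_eq (A := A), h]
      exact (norm_ip_le _ _).trans (mul_le_mul_of_nonneg_left (t.le_opNorm _) (norm_nonneg x))
    have h2 : 0 < ‖s x‖ := lt_of_le_of_ne (norm_nonneg _) (Ne.symm h0)
    nlinarith

end HilbertBimodule

open HilbertBimodule

/-- A Toeplitz representation `(ψ, π)` of the Hilbert bimodule `X` over `A` in `B`. -/
structure ToeplitzRep (A : Type u) (X : Type v) (B : Type w) [CStarAlgebra A] [PartialOrder A]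
    [NormedAddCommGroup X] [NormedSpace ℂ X] [Module Aᵐᵒᵖ X] [HilbertBimodule A X]
    [CStarAlgebra B] where
  ψ : X →ₗ[ℂ] B
  π : A →⋆ₙₐ[ℂ] B
  map_right : ∀ x (a : A), ψ (op a • x) = ψ x * π a
  map_ip : ∀ x y, star (ψ x) * ψ y = π (ip x y)
  map_left : ∀ (a : A) x, ψ (φ a x) = π a * ψ x

/-- Extension by continuity of a linear map defined on a dense image in a subspace. -/
def extendSubmodule {F : Type u} {E : Type v} {B : Type w} [AddCommGroup F] [Module ℂ F]
    [NormedAddCommGroup E] [NormedSpace ℂ E] [NormedAddCommGroup B] [NormedSpace ℂ B]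
    [CompleteSpace B] (K : Submodule ℂ E) (g : F →ₗ[ℂ] B) (e : F →ₗ[ℂ] K) : K →L[ℂ] B :=
  g.extendOfNorm e

theorem extendSubmodule_eq {F : Type u} {E : Type v} {B : Type w} [AddCommGroup F] [Module ℂ F]
    [NormedAddCommGroup E] [NormedSpace ℂ E] [NormedAddCommGroup B] [NormedSpace ℂ B]
    [CompleteSpace B] (K : Submodule ℂ E) (g : F →ₗ[ℂ] B) (e : F →ₗ[ℂ] K) (he : DenseRange e)
    (h : ∀ x, ‖g x‖ ≤ 1 * ‖e x‖) (x : F) : extendSubmodule K g e (e x) = g x :=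
  LinearMap.extendOfNorm_eq he ⟨1, h⟩ x

theorem le_of_pow_two_pow_le {a b D : ℝ} (hb : 0 ≤ b) (hD : 0 ≤ D)
    (h : ∀ k m : ℕ, 2 ^ k = m + 1 → a ^ (2 ^ k) ≤ D * b ^ m) : a ≤ b := by
  refine le_of_forall_pos_le_add fun ε hε => ?_
  by_contra! hlt
  have hs : 0 < b + ε := by linarith
  have h1 : 1 < a / (b + ε) := (one_lt_div hs).mpr hlt
  obtain ⟨n, hn⟩ := pow_unbounded_of_one_lt (D / (b + ε)) h1
  obtain ⟨m, hm⟩ := Nat.exists_eq_succ_of_ne_zero (pow_ne_zero n (two_ne_zero (α := ℕ)))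
  have h2 : (a / (b + ε)) ^ n ≤ (a / (b + ε)) ^ (2 ^ n) :=
    pow_le_pow_right₀ h1.le Nat.lt_two_pow_self.le
  have h3 : (a / (b + ε)) ^ (2 ^ n) ≤ D / (b + ε) := by
    rw [div_pow, div_le_div_iff₀ (by positivity) hs]
    have h4 := h n m hm
    have h5 : b ^ m ≤ (b + ε) ^ m := pow_le_pow_left₀ hb (by linarith) m
    have h6 : (b + ε) ^ (2 ^ n) = (b + ε) ^ m * (b + ε) := by rw [hm, pow_succ]
    rw [h6]
    calc a ^ 2 ^ n * (b + ε) ≤ D * b ^ m * (b + ε) := mul_le_mul_of_nonneg_right h4 hs.le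
      _ ≤ D * (b + ε) ^ m * (b + ε) := by gcongr
      _ = D * ((b + ε) ^ m * (b + ε)) := by ring
  linarith

namespace ToeplitzRep

variable {A : Type u} [CStarAlgebra A] [PartialOrder A] [StarOrderedRing A]
  {X : Type v} [NormedAddCommGroup X] [NormedSpace ℂ X] [Module Aᵐᵒᵖ X] [IsScalarTower ℂ Aᵐᵒᵖ X]
  [HilbertBimodule A X] {B : Type w} [CStarAlgebra B] (r : ToeplitzRep A X B)

theorem norm_ψ_le (x : X) : ‖r.ψ x‖ ≤ ‖x‖ := by
  have h : ‖r.ψ x‖ ^ 2 ≤ ‖x‖ ^ 2 := by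
    rw [sq, ← CStarRing.norm_star_mul_self, r.map_ip, norm_sq_eq (A := A)]
    exact NonUnitalStarAlgHom.norm_apply_le r.π _
  exact (pow_le_pow_iff_left₀ (norm_nonneg _) (norm_nonneg _) two_ne_zero).mp h

/-- The linear map sending the symbol of `Θ_{x,y}` to `ψ(x) ψ(y)*`. -/
def rankOneSum : (X × X →₀ ℂ) →ₗ[ℂ] B :=
  Finsupp.linearCombination ℂ fun p => r.ψ p.1 * star (r.ψ p.2)

theorem rankOneSum_mul_ψ (v : X × X →₀ ℂ) (z : X) :
    r.rankOneSum v * r.ψ z = r.ψ ((toCompacts A X v : X →L[ℂ] X) z) := by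
  induction v using Finsupp.induction_linear with
  | zero => simp
  | add f g hf hg => rw [map_add, add_mul, hf, hg, map_add, ← map_add]; rfl
  | single p c =>
    obtain ⟨x, y⟩ := p
    rw [toCompacts_single, rankOneSum, Finsupp.linearCombination_single, smul_mul_assoc,
      mul_assoc, r.map_ip, smul_apply, map_smul, Θ_apply, r.map_right]

theorem norm_rankOneSum_le (v : X × X →₀ ℂ) : ‖r.rankOneSum v‖ ≤ 1 * ‖toCompacts A X v‖ := by
  obtain ⟨v', hv1, hv2⟩ := exists_adjoint.{u, v, w} (A := A) v
  have hv3 : r.rankOneSum v' = star (r.rankOneSum v) := hv2 B r.ψ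
  set t : X →L[ℂ] X := (toCompacts A X v : X →L[ℂ] X) with ht
  set t' : X →L[ℂ] X := (toCompacts A X v' : X →L[ℂ] X) with ht'
  set b : B := star (r.rankOneSum v) * r.rankOneSum v with hb
  have hpow : ∀ (m : ℕ) (z : X), ‖b ^ m * r.ψ z‖ ≤ ‖t' * t‖ ^ m * ‖z‖ := by
    intro m z
    have : b ^ m * r.ψ z = r.ψ (((t' * t) ^ m) z) := by
      induction m generalizing z with
      | zero => simp
      | succ m ih =>
        have h1 : b * r.ψ z = r.ψ ((t' * t) z) := by
          rw [hb, mul_assoc, r.rankOneSum_mul_ψ, ← hv3, r.rankOneSum_mul_ψ]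
          rfl
        rw [pow_succ, mul_assoc, h1, ih, pow_succ]
        rfl
    rw [this]
    refine (r.norm_ψ_le _).trans ?_
    refine (ContinuousLinearMap.le_opNorm _ _).trans ?_
    have h0 : ‖(t' * t) ^ m‖ ≤ ‖t' * t‖ ^ m := by
      cases m with
      | zero => rw [pow_zero, pow_zero]; exact ContinuousLinearMap.norm_id_le
      | succ m => exact norm_pow_le' _ (Nat.succ_pos m)
    exact mul_le_mul_of_nonneg_right h0 (norm_nonneg z)
  have hsum : ∀ f : X × X →₀ ℂ, ∃ C : ℝ, 0 ≤ C ∧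
      ∀ m : ℕ, ‖b ^ m * r.rankOneSum f‖ ≤ C * ‖t' * t‖ ^ m := by
    intro f
    induction f using Finsupp.induction_linear with
    | zero => exact ⟨0, le_rfl, fun m => by simp⟩
    | add f g hf hg =>
      obtain ⟨C, hC0, hC⟩ := hf
      obtain ⟨D, hD0, hD⟩ := hg
      refine ⟨C + D, add_nonneg hC0 hD0, fun m => ?_⟩
      rw [map_add, mul_add, add_mul]
      exact (norm_add_le _ _).trans (add_le_add (hC m) (hD m))
    | single p c =>
      obtain ⟨x, y⟩ := p
      refine ⟨‖c‖ * (‖x‖ * ‖y‖), by positivity, fun m => ?_⟩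
      rw [rankOneSum, Finsupp.linearCombination_single, mul_smul_comm, norm_smul, ← mul_assoc]
      calc ‖c‖ * ‖b ^ m * r.ψ x * star (r.ψ y)‖
          ≤ ‖c‖ * (‖b ^ m * r.ψ x‖ * ‖star (r.ψ y)‖) := by gcongr; exact norm_mul_le _ _
        _ ≤ ‖c‖ * ((‖t' * t‖ ^ m * ‖x‖) * ‖y‖) := by
            gcongr
            · exact hpow m x
            · rw [norm_star]; exact r.norm_ψ_le y
        _ = ‖c‖ * (‖x‖ * ‖y‖) * ‖t' * t‖ ^ m := by ring
  obtain ⟨C, hC0, hC⟩ := hsum v'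
  have hbs : IsSelfAdjoint b := IsSelfAdjoint.star_mul_self _
  have hbt : ‖b‖ ≤ ‖t' * t‖ := by
    refine le_of_pow_two_pow_le (D := C * ‖r.rankOneSum v‖) (norm_nonneg _)
      (by positivity) fun k m hkm => ?_
    have h1 : ‖b‖ ^ 2 ^ k = ‖b ^ 2 ^ k‖ := by
      have := hbs.nnnorm_pow_two_pow k
      exact (congrArg NNReal.toReal this).symm
    rw [h1, hkm, pow_succ]
    nth_rewrite 2 [hb]
    rw [← hv3, ← mul_assoc]
    calc ‖b ^ m * r.rankOneSum v' * r.rankOneSum v‖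
        ≤ ‖b ^ m * r.rankOneSum v'‖ * ‖r.rankOneSum v‖ := norm_mul_le _ _
      _ ≤ C * ‖t' * t‖ ^ m * ‖r.rankOneSum v‖ := by gcongr; exact hC m
      _ = C * ‖r.rankOneSum v‖ * ‖t' * t‖ ^ m := by ring
  have h2 : ‖r.rankOneSum v‖ ^ 2 ≤ ‖t‖ ^ 2 := by
    rw [sq, ← CStarRing.norm_star_mul_self, sq]
    refine hbt.trans ((norm_mul_le _ _).trans ?_)
    exact mul_le_mul_of_nonneg_right (opNorm_adjoint_le (A := A) hv1) (norm_nonneg t)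
  rw [one_mul]
  exact (pow_le_pow_iff_left₀ (norm_nonneg _) (norm_nonneg _) two_ne_zero).mp h2

/-- The map `(ψ, π)^{(1)} : 𝒦(X) → B`, the unique continuous linear map with
`(ψ, π)^{(1)}(Θ_{x,y}) = ψ(x) ψ(y)*`. -/
def compactMap : compacts A X →L[ℂ] B :=
  extendSubmodule (compacts A X) r.rankOneSum (toCompacts A X)

theorem compactMap_Θ (x y : X) :
    r.compactMap ⟨Θ A x y, Θ_mem_compacts x y⟩ = r.ψ x * star (r.ψ y) := by
  have h := extendSubmodule_eq (compacts A X) r.rankOneSum (toCompacts A X)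
    denseRange_toCompacts r.norm_rankOneSum_le (Finsupp.single (x, y) 1)
  rw [rankOneSum, toCompacts, Finsupp.linearCombination_single,
    Finsupp.linearCombination_single, one_smul, one_smul] at h
  exact h

end ToeplitzRep

end HilbertBimodule

/-! ### The Hilbert bimodule `M_L` -/

section ExelModule

open MulOpposite HilbertBimodule

variable {A : Type u} [CStarAlgebra A] [PartialOrder A] [StarOrderedRing A]
  {α : A →⋆ₙₐ[ℂ] A} (L : TransferOperator α)

theorem TransferOperator.map_star (a : A) : L (star a) = star (L a) :=
  StarHomClass.map_star (PositiveLinearMap.mk₀ (L.toCLM : A →ₗ[ℂ] A) L.nonneg') a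

theorem TransferOperator.mono {a b : A} (h : a ≤ b) : L a ≤ L b := by
  rw [← sub_nonneg, ← map_sub]; exact L.nonneg' _ (sub_nonneg.mpr h)

theorem TransferOperator.map_mul (a b : A) : L (α a * b) = a * L b := L.map_mul' a b

theorem TransferOperator.map_mul_right (a b : A) : L (b * α a) = L b * a := by
  have h := L.map_mul (star a) (star b)
  rw [StarHomClass.map_star, ← star_mul, L.map_star, L.map_star, ← star_mul] at h
  exact star_injective h

/-- The space `A_L`: a copy of `A`, with right action `m · a = m α(a)`, the `A`-valued form
`⟨m, n⟩ = L(m* n)` and the seminorm `‖m‖ = ‖⟨m, m⟩‖^{1/2}`. -/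
def PreExelModule (_L : TransferOperator α) : Type u := A

namespace PreExelModule

instance : AddCommGroup (PreExelModule L) := inferInstanceAs (AddCommGroup A)
instance : Module ℂ (PreExelModule L) := inferInstanceAs (Module ℂ A)

/-- The identity map from `A` to `A_L`. -/
def of : A ≃ₗ[ℂ] PreExelModule L := LinearEquiv.refl ℂ A

/-- The identity map from `A_L` to `A`. -/
def un : PreExelModule L ≃ₗ[ℂ] A := LinearEquiv.refl ℂ A

/-- The form `⟨m, n⟩ = L(m* n)` on `A_L`. -/
def form (m n : PreExelModule L) : A := L (star (un L m) * un L n)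

theorem form_nonneg (m : PreExelModule L) : 0 ≤ form L m m := L.nonneg' _ (star_mul_self_nonneg _)

theorem norm_form_sq_le (m n : PreExelModule L) :
    ‖form L m n‖ ^ 2 ≤ ‖form L m m‖ * ‖form L n n‖ := by
  refine cauchySchwarz_aux (form_nonneg L m) fun a t => ?_
  have h := L.nonneg' _ (star_mul_self_nonneg (un L m * α a - (t : ℂ) • un L n))
  convert h using 1
  have e : star (un L m * α a - (t : ℂ) • un L n) * (un L m * α a - (t : ℂ) • un L n) =
      α (star a) * (star (un L m) * un L m * α a)
        - (t : ℂ) • (α (star a) * (star (un L m) * un L n))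
        - (t : ℂ) • (star (un L n) * un L m * α a)
        + (t : ℂ) • (t : ℂ) • (star (un L n) * un L n) := by
    simp only [star_sub, star_mul, star_smul, Complex.star_def, Complex.conj_ofReal, sub_mul,
      mul_sub, smul_mul_assoc, mul_smul_comm, mul_assoc, StarHomClass.map_star, smul_sub]
    abel
  rw [e]
  have hs : star (form L m n) = form L n m := by
    rw [form, ← L.map_star, star_mul, star_star, form]
  rw [hs]
  simp only [map_add, map_sub, map_smul, L.map_mul, L.map_mul_right]
  simp only [Complex.coe_smul, form, mul_assoc]

/-- The seminorm of `A_L`. -/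
def seminorm : Seminorm ℂ (PreExelModule L) :=
  Seminorm.ofSMulLE (fun m => √‖form L m m‖)
    (by simp [form])
    (fun m n => by
      refine Real.sqrt_le_iff.mpr ⟨by positivity, ?_⟩
      have h1 := norm_form_sq_le L m n
      have h2 := norm_form_sq_le L n m
      have e1 := Real.sq_sqrt (norm_nonneg (form L m m))
      have e2 := Real.sq_sqrt (norm_nonneg (form L n n))
      have n1 := Real.sqrt_nonneg ‖form L m m‖
      have n2 := Real.sqrt_nonneg ‖form L n n‖
      have h3 : ‖form L m n‖ ≤ √‖form L m m‖ * √‖form L n n‖ := by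
        refine (pow_le_pow_iff_left₀ (norm_nonneg _) (by positivity) two_ne_zero).mp ?_
        rw [mul_pow, e1, e2]; exact h1
      have h4 : ‖form L n m‖ ≤ √‖form L m m‖ * √‖form L n n‖ := by
        refine (pow_le_pow_iff_left₀ (norm_nonneg _) (by positivity) two_ne_zero).mp ?_
        rw [mul_pow, e1, e2, mul_comm]; exact h2
      have e : form L (m + n) (m + n) =
          form L m m + form L m n + (form L n m + form L n n) := by
        simp only [form, map_add, star_add, add_mul, mul_add]
        abel
      rw [e]
      calc _ ≤ ‖form L m m‖ + ‖form L m n‖ + (‖form L n m‖ + ‖form L n n‖) :=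
            (norm_add_le _ _).trans (add_le_add (norm_add_le _ _) (norm_add_le _ _))
        _ ≤ _ := by nlinarith)
    (fun c m => by
      have e : form L (c • m) (c • m) = (star c * c) • form L m m := by
        simp only [form, map_smul, star_smul, smul_mul_assoc, mul_smul_comm, smul_smul,
          mul_comm]
      rw [e, norm_smul, norm_mul, norm_star, Real.sqrt_mul (by positivity),
        Real.sqrt_mul_self (norm_nonneg c)])

instance : SeminormedAddCommGroup (PreExelModule L) :=
  (seminorm L).toAddGroupSeminorm.toSeminormedAddCommGroup

theorem norm_def (m : PreExelModule L) : ‖m‖ = √‖form L m m‖ := rfl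

theorem norm_sq (m : PreExelModule L) : ‖m‖ ^ 2 = ‖form L m m‖ := Real.sq_sqrt (norm_nonneg _)

instance : NormedSpace ℂ (PreExelModule L) where
  norm_smul_le c m := ((seminorm L).smul' c m).le

theorem norm_form_le (m n : PreExelModule L) : ‖form L m n‖ ≤ ‖m‖ * ‖n‖ := by
  refine (pow_le_pow_iff_left₀ (norm_nonneg _) (by positivity) two_ne_zero).mp ?_
  rw [mul_pow, norm_sq, norm_sq]
  exact norm_form_sq_le L m n

/-- Right action of `a` on `A_L`: multiplication by `α(a)` on the right. -/
def right (a : A) : PreExelModule L →L[ℂ] PreExelModule L :=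
  LinearMap.mkContinuous
    ((of L).toLinearMap ∘ₗ LinearMap.mulRight ℂ (α a) ∘ₗ (un L).toLinearMap) ‖a‖ fun m => by
      refine (pow_le_pow_iff_left₀ (norm_nonneg _) (by positivity) two_ne_zero).mp ?_
      rw [mul_pow, norm_sq, norm_sq]
      change ‖L (star (un L m * α a) * (un L m * α a))‖ ≤ _
      rw [star_mul, ← StarHomClass.map_star, ← mul_assoc, L.map_mul_right, mul_assoc, L.map_mul]
      calc ‖star a * form L m m * a‖ ≤ ‖star a‖ * ‖form L m m‖ * ‖a‖ := norm_mul₃_le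
        _ = ‖a‖ ^ 2 * ‖form L m m‖ := by rw [norm_star]; ring

/-- Left action of `a` on `A_L`: multiplication by `a` on the left. -/
def left (a : A) : PreExelModule L →L[ℂ] PreExelModule L :=
  LinearMap.mkContinuous
    ((of L).toLinearMap ∘ₗ LinearMap.mulLeft ℂ a ∘ₗ (un L).toLinearMap) ‖a‖ fun m => by
      refine (pow_le_pow_iff_left₀ (norm_nonneg _) (by positivity) two_ne_zero).mp ?_
      rw [mul_pow, norm_sq, norm_sq]
      change ‖L (star (a * un L m) * (a * un L m))‖ ≤ _
      have h : star (a * un L m) * (a * un L m) ≤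
          ‖star a * a‖ • (star (un L m) * un L m) := by
        rw [star_mul, mul_assoc, ← mul_assoc (star a), ← mul_assoc]
        exact CStarAlgebra.star_left_conjugate_le_norm_smul (IsSelfAdjoint.star_mul_self a)
      have h2 := L.mono h
      rw [LinearMapClass.map_smul_of_tower] at h2
      refine (CStarAlgebra.norm_le_norm_of_nonneg_of_le
        (L.nonneg' _ (star_mul_self_nonneg _)) h2).trans ?_
      rw [norm_smul, norm_norm, CStarRing.norm_star_mul_self, ← sq]
      rfl

end PreExelModule

/-- The Hilbert bimodule `M_L`: the Hausdorff completion of `A_L`. -/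
def ExelModule : Type u := Completion (PreExelModule L)

namespace ExelModule

instance : NormedAddCommGroup (ExelModule L) :=
  inferInstanceAs (NormedAddCommGroup (Completion (PreExelModule L)))
instance : NormedSpace ℂ (ExelModule L) :=
  inferInstanceAs (NormedSpace ℂ (Completion (PreExelModule L)))
instance : CompleteSpace (ExelModule L) :=
  inferInstanceAs (CompleteSpace (Completion (PreExelModule L)))

/-- The canonical map `q : A → M_L`. -/
def q : A →ₗ[ℂ] ExelModule L where
  toFun a := ((PreExelModule.of L a : PreExelModule L) : Completion (PreExelModule L))
  map_add' a b := Completion.coe_add (PreExelModule.of L a) (PreExelModule.of L b)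
  map_smul' c a := Completion.coe_smul c (PreExelModule.of L a)

theorem norm_q (a : A) : ‖q L a‖ ^ 2 = ‖L (star a * a)‖ := by
  have h : ‖q L a‖ = ‖PreExelModule.of L a‖ := Completion.norm_coe _
  rw [h, PreExelModule.norm_sq]; rfl

theorem denseRange_q : DenseRange (q L) := Completion.denseRange_coe (α := PreExelModule L)

theorem induction {P : ExelModule L → Prop} (x : ExelModule L) (hc : IsClosed {x | P x})
    (h : ∀ a, P (q L a)) : P x := (denseRange_q L).induction_on x hc h

theorem induction₂ {P : ExelModule L → ExelModule L → Prop} (x y : ExelModule L)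
    (hc : IsClosed {x : ExelModule L × ExelModule L | P x.1 x.2})
    (h : ∀ a b, P (q L a) (q L b)) : P x y := Completion.induction_on₂ x y hc h

/-- The `A`-valued inner product on `M_L`, extending `⟨q(a), q(b)⟩ = L(a* b)`. -/
def inner : ExelModule L → ExelModule L → A :=
  Function.curry ((Completion.isDenseInducing_coe.prodMap Completion.isDenseInducing_coe).extend
    (Function.uncurry (PreExelModule.form L)))

theorem continuous_form : Continuous (Function.uncurry (PreExelModule.form L)) := by
  let f : PreExelModule L →ₗ⋆[ℂ] PreExelModule L →ₗ[ℂ] A :=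
    LinearMap.mk₂'ₛₗ (starRingEnd ℂ) (RingHom.id ℂ) (PreExelModule.form L)
      (fun m n k => by simp only [PreExelModule.form, map_add, star_add, add_mul])
      (fun c m n => by
        simp only [PreExelModule.form, map_smul, star_smul, smul_mul_assoc]; rfl)
      (fun m n k => by simp only [PreExelModule.form, map_add, mul_add])
      (fun c m n => by
        simp only [PreExelModule.form, map_smul, mul_smul_comm]; rfl)
  let F : PreExelModule L →L⋆[ℂ] PreExelModule L →L[ℂ] A :=
    LinearMap.mkContinuous₂ f 1 fun m n => by
      rw [one_mul]; exact PreExelModule.norm_form_le L m n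
  have h : Function.uncurry (PreExelModule.form L) = fun p => F p.1 p.2 := rfl
  rw [h]
  fun_prop

theorem inner_q (a b : A) : inner L (q L a) (q L b) = L (star a * b) :=
  (Completion.isDenseInducing_coe.prodMap Completion.isDenseInducing_coe).extend_eq
    (continuous_form L) (PreExelModule.of L a, PreExelModule.of L b)

theorem continuous_inner : Continuous (fun p : ExelModule L × ExelModule L => inner L p.1 p.2) := by
  let f : PreExelModule L →+ PreExelModule L →+ A :=
    AddMonoidHom.mk' (fun m => AddMonoidHom.mk' (PreExelModule.form L m)
      (fun n k => by simp only [PreExelModule.form, map_add, mul_add]))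
      (fun m n => by
        ext k
        change PreExelModule.form L (m + n) k = PreExelModule.form L m k + PreExelModule.form L n k
        simp only [PreExelModule.form, map_add, star_add, add_mul])
  have hf : Continuous fun p : PreExelModule L × PreExelModule L => f p.1 p.2 := continuous_form L
  exact (Completion.isDenseInducing_toCompl (PreExelModule L)).extend_Z_bilin
    (Completion.isDenseInducing_toCompl (PreExelModule L)) hf

theorem continuous_inner' {Y : Type*} [TopologicalSpace Y] {f g : Y → ExelModule L}
    (hf : Continuous f) (hg : Continuous g) : Continuous fun y => inner L (f y) (g y) :=
  (continuous_inner L).comp (hf.prodMk hg)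

/-- Right action of `a` on `M_L`, with `q(m) · a = q(m α(a))`. -/
def right (a : A) : ExelModule L →L[ℂ] ExelModule L := (PreExelModule.right L a).completion

theorem right_q (a m : A) : right L a (q L m) = q L (m * α a) :=
  ContinuousLinearMap.completion_apply_coe _ _

/-- Left action of `a` on `M_L`, with `a · q(m) = q(a m)`. -/
def left (a : A) : ExelModule L →L[ℂ] ExelModule L := (PreExelModule.left L a).completion

theorem left_q (a m : A) : left L a (q L m) = q L (a * m) :=
  ContinuousLinearMap.completion_apply_coe _ _

theorem ext_q {f g : ExelModule L →L[ℂ] ExelModule L} (h : ∀ a, f (q L a) = g (q L a)) : f = g :=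
  ContinuousLinearMap.ext fun x =>
    induction L (P := fun x => f x = g x) x (isClosed_eq f.continuous g.continuous) h

theorem inner_self_nonneg (x : ExelModule L) : 0 ≤ inner L x x := by
  refine induction L (P := fun x => 0 ≤ inner L x x) x ?_ fun a => ?_
  · exact (CStarAlgebra.isClosed_nonneg (A := A)).preimage
      (continuous_inner' L continuous_id continuous_id)
  · rw [inner_q]; exact L.nonneg' _ (star_mul_self_nonneg a)

theorem right_one : right L 1 = ContinuousLinearMap.id ℂ (ExelModule L) := by
  refine ext_q L fun m => ?_
  rw [right_q, ContinuousLinearMap.id_apply, ← sub_eq_zero, ← map_sub, ← norm_eq_zero,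
    ← pow_eq_zero_iff two_ne_zero, norm_q]
  have h : star (m * α 1 - m) * (m * α 1 - m) =
      α 1 * (star m * m) * α 1 - α 1 * (star m * m) - (star m * m) * α 1 + star m * m := by
    have h1 : star (α 1) = α 1 := by rw [← StarHomClass.map_star, star_one]
    rw [star_sub, star_mul, h1]
    noncomm_ring
  rw [h, map_add, map_sub, map_sub, L.map_mul_right, L.map_mul_right, L.map_mul]
  simp

instance : Module Aᵐᵒᵖ (ExelModule L) where
  smul a x := right L (unop a) x
  one_smul x := by
    change right L 1 x = x
    rw [right_one]; rfl
  mul_smul a b x := by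
    have h : right L (unop (a * b)) = (right L (unop a)).comp (right L (unop b)) :=
      ext_q L fun m => by
        rw [ContinuousLinearMap.comp_apply, right_q, right_q, right_q, unop_mul, map_mul α,
          mul_assoc]
    exact congrArg (fun f : ExelModule L →L[ℂ] ExelModule L => f x) h
  smul_zero a := map_zero (right L (unop a))
  smul_add a := map_add (right L (unop a))
  add_smul a b x := by
    have h : right L (unop (a + b)) = right L (unop a) + right L (unop b) :=
      ext_q L fun m => by
        rw [add_apply, right_q, right_q, right_q, unop_add, map_add α, mul_add, map_add]
    exact congrArg (fun f : ExelModule L →L[ℂ] ExelModule L => f x) h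
  zero_smul x := by
    have h : right L 0 = 0 := ext_q L fun m => by
      rw [right_q, map_zero α, mul_zero, map_zero]; rfl
    exact congrArg (fun f : ExelModule L →L[ℂ] ExelModule L => f x) h

theorem op_smul_def (a : A) (x : ExelModule L) : op a • x = right L a x := rfl

theorem op_smul_q (a m : A) : op a • q L m = q L (m * α a) := right_q L a m

instance : IsScalarTower ℂ Aᵐᵒᵖ (ExelModule L) where
  smul_assoc c a x := by
    have h : right L (unop (c • a)) = c • right L (unop a) :=
      ext_q L fun m => by
        rw [smul_apply, right_q, right_q, unop_smul, map_smul α, mul_smul_comm, map_smul]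
    exact congrArg (fun f : ExelModule L →L[ℂ] ExelModule L => f x) h

instance : HilbertBimodule A (ExelModule L) where
  ip := inner L
  ip_add_right x y z := by
    refine induction L (P := fun x => inner L x (y + z) = inner L x y + inner L x z) x
      (isClosed_eq (continuous_inner' L continuous_id continuous_const)
        ((continuous_inner' L continuous_id continuous_const).add
          (continuous_inner' L continuous_id continuous_const))) fun a => ?_
    refine induction₂ L (P := fun y z => inner L (q L a) (y + z) =
        inner L (q L a) y + inner L (q L a) z) y z
      (isClosed_eq (continuous_inner' L continuous_const continuous_add)
        ((continuous_inner' L continuous_const continuous_fst).add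
          (continuous_inner' L continuous_const continuous_snd))) fun b c => ?_
    rw [← map_add, inner_q, inner_q, inner_q, mul_add, map_add]
  ip_smul_right c x y := by
    refine induction₂ L (P := fun x y => inner L x (c • y) = c • inner L x y) x y
      (isClosed_eq (continuous_inner' L continuous_fst (continuous_snd.const_smul c))
        ((continuous_inner L).const_smul c)) fun a b => ?_
    rw [← map_smul, inner_q, inner_q, mul_smul_comm, map_smul]
  ip_op_smul_right c x y := by
    refine induction₂ L (P := fun x y => inner L x (right L c y) = inner L x y * c) x y
      (isClosed_eq (continuous_inner' L continuous_fst
        ((right L c).continuous.comp continuous_snd))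
        ((continuous_inner L).mul continuous_const)) fun a b => ?_
    rw [right_q, inner_q, inner_q, ← mul_assoc, L.map_mul_right]
  star_ip x y := by
    refine induction₂ L (P := fun x y => star (inner L x y) = inner L y x) x y
      (isClosed_eq (continuous_inner L).star
        (continuous_inner' L continuous_snd continuous_fst)) fun a b => ?_
    rw [inner_q, inner_q, ← L.map_star, star_mul, star_star]
  ip_self_nonneg := inner_self_nonneg L
  norm_sq_eq x := by
    refine induction L (P := fun x => ‖x‖ ^ 2 = ‖inner L x x‖) x
      (isClosed_eq (continuous_norm.pow 2)
        (continuous_inner' L continuous_id continuous_id).norm) fun a => ?_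
    rw [norm_q, inner_q]
  φ :=
    { toFun := left L
      map_smul' := fun c a => ext_q L fun m => by
        change left L (c • a) (q L m) = c • left L a (q L m)
        rw [left_q, left_q, smul_mul_assoc, map_smul]
      map_zero' := ext_q L fun m => by
        rw [left_q, zero_mul, map_zero]; rfl
      map_add' := fun a b => ext_q L fun m => by
        rw [add_apply, left_q, left_q, left_q, add_mul, map_add]
      map_mul' := fun a b => ext_q L fun m => by
        change left L (a * b) (q L m) = left L a (left L b (q L m))
        rw [left_q, left_q, left_q, mul_assoc] }
  ip_φ_left c x y := by
    refine induction₂ L (P := fun x y => inner L (left L c x) y = inner L x (left L (star c) y))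
      x y (isClosed_eq
        (continuous_inner' L ((left L c).continuous.comp continuous_fst) continuous_snd)
        (continuous_inner' L continuous_fst ((left L (star c)).continuous.comp continuous_snd)))
      fun a b => ?_
    rw [left_q, left_q, inner_q, inner_q, star_mul, mul_assoc]

theorem ip_q (a b : A) : ip (q L a) (q L b) = L (star a * b) := inner_q L a b

theorem φ_q (a b : A) : (φ a : ExelModule L →L[ℂ] ExelModule L) (q L b) = q L (a * b) :=
  left_q L a b

end ExelModule

/-! ### The Toeplitz representation of `M_L` induced by a Toeplitz-covariant representation -/

namespace ToeplitzCovariantRep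

variable {L} {B : Type v} [CStarAlgebra B] (r : ToeplitzCovariantRep L B)

/-- The map `a ↦ ρ(a) V` on `A_L`. -/
def preψ : PreExelModule L →L[ℂ] B :=
  LinearMap.mkContinuous
    (LinearMap.mulRight ℂ r.V ∘ₗ (r.ρ : A →ₐ[ℂ] B).toLinearMap ∘ₗ
      (PreExelModule.un L).toLinearMap) 1 fun m => by
      refine (pow_le_pow_iff_left₀ (norm_nonneg _) (by positivity) two_ne_zero).mp ?_
      rw [one_mul, PreExelModule.norm_sq, sq, ← CStarRing.norm_star_mul_self]
      change ‖star (r.ρ (PreExelModule.un L m) * r.V) * (r.ρ (PreExelModule.un L m) * r.V)‖ ≤ _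
      rw [star_mul, mul_assoc, ← mul_assoc (star (r.ρ _)), ← StarHomClass.map_star, ← _root_.map_mul,
        ← mul_assoc, r.conj]
      exact NonUnitalStarAlgHom.norm_apply_le r.ρ _

/-- The bounded linear map `ψ_V : M_L → B` with `ψ_V(q(a)) = ρ(a) V`. -/
def ψ : ExelModule L →L[ℂ] B := r.preψ.fromCompletion

theorem ψ_q (a : A) : r.ψ (ExelModule.q L a) = r.ρ a * r.V :=
  ContinuousLinearMap.fromCompletion_apply_coe _ _

/-- The Toeplitz representation `(ψ_V, ρ)` of `M_L`. -/
def toToeplitzRep : ToeplitzRep A (ExelModule L) B where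
  ψ := r.ψ
  π := r.ρ
  map_right x a := by
    refine ExelModule.induction L (P := fun x => r.ψ (ExelModule.right L a x) = r.ψ x * r.ρ a) x
      (isClosed_eq (r.ψ.continuous.comp (ExelModule.right L a).continuous)
        (r.ψ.continuous.mul continuous_const)) fun m => ?_
    rw [ExelModule.right_q, ψ_q, ψ_q, _root_.map_mul, mul_assoc, mul_assoc, r.comm]
  map_ip x y := by
    have hc : Continuous r.ρ := AddMonoidHomClass.continuous_of_bound r.ρ 1 fun a => by
      rw [one_mul]; exact NonUnitalStarAlgHom.norm_apply_le r.ρ a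
    refine ExelModule.induction₂ L (P := fun x y => star (r.ψ x) * r.ψ y =
      r.ρ (ExelModule.inner L x y)) x y
      (isClosed_eq ((r.ψ.continuous.comp continuous_fst).star.mul
        (r.ψ.continuous.comp continuous_snd)) (hc.comp (ExelModule.continuous_inner L)))
      fun a b => ?_
    rw [ψ_q, ψ_q, ExelModule.inner_q, star_mul, mul_assoc, ← mul_assoc (star (r.ρ _)),
      ← StarHomClass.map_star, ← _root_.map_mul, ← mul_assoc, r.conj]
  map_left a x := by
    refine ExelModule.induction L (P := fun x => r.ψ (ExelModule.left L a x) = r.ρ a * r.ψ x) x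
      (isClosed_eq (r.ψ.continuous.comp (ExelModule.left L a).continuous)
        (continuous_const.mul r.ψ.continuous)) fun m => ?_
    rw [ExelModule.left_q, ψ_q, ψ_q, _root_.map_mul, mul_assoc]

end ToeplitzCovariantRep

end ExelModule

/-! ### Quotients of `C*`-algebras by closed ideals -/

section Quotient

variable {B : Type u} [CStarAlgebra B]

/-- The closed two-sided ideal generated by a set. -/
def closedIdeal (s : Set B) : Ideal B :=
  sInf {I : Ideal B | I.IsTwoSided ∧ IsClosed (I : Set B) ∧ s ⊆ I}

theorem mem_closedIdeal {s : Set B} {x : B} : x ∈ closedIdeal s ↔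
    ∀ I : Ideal B, I.IsTwoSided → IsClosed (I : Set B) → s ⊆ I → x ∈ I := by
  rw [closedIdeal, Submodule.mem_sInf]
  exact ⟨fun h I h1 h2 h3 => h I ⟨h1, h2, h3⟩, fun h I hI => h I hI.1 hI.2.1 hI.2.2⟩

theorem subset_closedIdeal (s : Set B) : s ⊆ closedIdeal s := fun _ hx =>
  mem_closedIdeal.mpr fun _ _ _ h3 => h3 hx

instance (s : Set B) : (closedIdeal s).IsTwoSided where
  mul_mem_of_left b ha := mem_closedIdeal.mpr fun I h1 h2 h3 =>
    h1.mul_mem_of_left b (mem_closedIdeal.mp ha I h1 h2 h3)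

instance (s : Set B) : IsClosed (closedIdeal s : Set B) := by
  rw [closedIdeal, Submodule.coe_sInf]
  exact isClosed_biInter fun I hI => hI.2.1

theorem exists_cutoff [PartialOrder B] [StarOrderedRing B] {m : B} (hm : 0 ≤ m) {ε : ℝ}
    (hε : 0 < ε) : ∃ r : B, IsSelfAdjoint (1 - m * r) ∧ ‖1 - m * r‖ ≤ 1 ∧
      ‖(1 - m * r) * m * (1 - m * r)‖ ≤ ε := by
  have hsa : IsSelfAdjoint m := IsSelfAdjoint.of_nonneg hm
  have hpos : ∀ t ∈ spectrum ℝ m, 0 ≤ t := fun t ht => spectrum_nonneg_of_nonneg hm ht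
  have hne : ∀ t ∈ spectrum ℝ m, ε + t ≠ 0 := fun t ht => by linarith [hpos t ht]
  have hc1 : ContinuousOn (fun t : ℝ => (ε + t)⁻¹) (spectrum ℝ m) :=
    ContinuousOn.inv₀ (by fun_prop) hne
  have hci : ContinuousOn (fun t : ℝ => t) (spectrum ℝ m) := continuousOn_id
  have hcm : ContinuousOn (fun t : ℝ => t * (ε + t)⁻¹) (spectrum ℝ m) := hci.mul hc1
  have hc2 : ContinuousOn (fun t : ℝ => 1 - t * (ε + t)⁻¹) (spectrum ℝ m) :=
    continuousOn_const.sub hcm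
  have hd : 1 - m * cfc (fun t : ℝ => (ε + t)⁻¹) m =
      cfc (fun t : ℝ => 1 - t * (ε + t)⁻¹) m := by
    rw [cfc_sub (fun _ : ℝ => (1 : ℝ)) (fun t : ℝ => t * (ε + t)⁻¹) m
      continuousOn_const hcm, cfc_const_one ℝ m,
      cfc_mul (fun t : ℝ => t) (fun t : ℝ => (ε + t)⁻¹) m hci hc1, cfc_id' ℝ m]
  have hval : ∀ t ∈ spectrum ℝ m, 1 - t * (ε + t)⁻¹ = ε * (ε + t)⁻¹ := fun t ht => by
    field_simp [hne t ht]; ring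
  refine ⟨cfc (fun t : ℝ => (ε + t)⁻¹) m, ?_⟩
  rw [hd]
  refine ⟨cfc_predicate _ m, norm_cfc_le zero_le_one fun t ht => ?_, ?_⟩
  · have h0 := hpos t ht
    rw [hval t ht, Real.norm_of_nonneg (by positivity), ← div_eq_mul_inv]
    exact div_le_one_of_le₀ (by linarith) (by linarith)
  · have he : cfc (fun t : ℝ => 1 - t * (ε + t)⁻¹) m * m * cfc (fun t : ℝ => 1 - t * (ε + t)⁻¹) m =
        cfc (fun t : ℝ => (1 - t * (ε + t)⁻¹) * t * (1 - t * (ε + t)⁻¹)) m := by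
      rw [cfc_mul (fun t : ℝ => (1 - t * (ε + t)⁻¹) * t) (fun t : ℝ => 1 - t * (ε + t)⁻¹) m
          (hc2.mul hci) hc2,
        cfc_mul (fun t : ℝ => 1 - t * (ε + t)⁻¹) (fun t : ℝ => t) m hc2 hci, cfc_id' ℝ m]
    rw [he]
    refine norm_cfc_le hε.le fun t ht => ?_
    have h0 := hpos t ht
    have h1 : 0 < ε + t := by linarith
    rw [hval t ht, Real.norm_of_nonneg (by positivity)]
    have : ε * (ε + t)⁻¹ * t * (ε * (ε + t)⁻¹) = ε * ((ε * t) / (ε + t) ^ 2) := by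
      field_simp
    rw [this]
    refine mul_le_of_le_one_right hε.le (div_le_one_of_le₀ ?_ (by positivity))
    nlinarith [mul_nonneg hε.le h0]

variable (I : Ideal B) [I.IsTwoSided] [hI : IsClosed (I : Set B)]

theorem star_mem_of_closed {x : B} (hx : x ∈ I) : star x ∈ I := by
  let _ := CStarAlgebra.spectralOrder B
  have := CStarAlgebra.spectralOrderedRing B
  have h : star x ∈ closure (I : Set B) := by
    refine Metric.mem_closure_iff.mpr fun ε hε => ?_
    obtain ⟨r, h1, h2, h3⟩ := exists_cutoff (mul_star_self_nonneg x)
      (show (0 : ℝ) < (ε / 2) ^ 2 by positivity)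
    refine ⟨star x * (x * star x * r), ?_, ?_⟩
    · exact I.mul_mem_left _ (I.mul_mem_right _ (I.mul_mem_right _ hx))
    · have e : star x - star x * (x * star x * r) = star x * (1 - x * star x * r) := by
        rw [mul_sub, mul_one]
      rw [dist_eq_norm, e]
      have h4 : ‖star x * (1 - x * star x * r)‖ ^ 2 ≤ (ε / 2) ^ 2 := by
        rw [sq, ← CStarRing.norm_star_mul_self, star_mul, star_star, h1.star_eq, mul_assoc,
          ← mul_assoc x, ← mul_assoc]
        exact h3
      have h5 := (pow_le_pow_iff_left₀ (norm_nonneg _) (by positivity) two_ne_zero).mp h4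
      linarith
  rwa [hI.closure_eq] at h

theorem exists_norm_sq_le (x j : B) (hj : j ∈ I) {ε : ℝ} (hε : 0 < ε) :
    ∃ k ∈ I, ‖x - k‖ ^ 2 ≤ ‖star x * x + j‖ + ε := by
  let _ := CStarAlgebra.spectralOrder B
  have := CStarAlgebra.spectralOrderedRing B
  set c : ℝ := ‖star x * x + j‖ with hc
  set δ : ℝ := ε / 2 with hδ
  have hδ0 : 0 < δ := by positivity
  set j' : B := (2⁻¹ : ℝ) • (j + star j) with hj'
  have hsj : star j' = j' := by
    rw [hj', star_smul, star_add, star_star, add_comm, star_trivial]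
  have hmem : j' ∈ I := by
    have h1 : j + star j ∈ I := I.add_mem hj (star_mem_of_closed I hj)
    have h2 : j' = ((2⁻¹ : ℝ) • (1 : B)) * (j + star j) := by rw [smul_one_mul]
    rw [h2]
    exact I.mul_mem_left _ h1
  have hsx : IsSelfAdjoint (star x * x + j') := by
    rw [IsSelfAdjoint, star_add, star_mul, star_star, hsj]
  have hle : star x * x + j' ≤ algebraMap ℝ B c := by
    refine hsx.le_algebraMap_norm_self.trans ?_
    refine algebraMap_mono B ?_
    have e : star x * x + j' = (2⁻¹ : ℝ) • ((star x * x + j) + star (star x * x + j)) := by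
      rw [hj', star_add, star_mul, star_star]
      have : star x * x = (2⁻¹ : ℝ) • (star x * x + star x * x) := by
        rw [← two_smul ℝ, smul_smul]; norm_num
      nth_rewrite 1 [this]
      rw [← smul_add]
      congr 1
      abel
    rw [e, norm_smul]
    have := norm_add_le (star x * x + j) (star (star x * x + j))
    rw [norm_star, ← hc] at this
    rw [Real.norm_of_nonneg (by norm_num)]
    linarith
  set m : B := (4 * δ)⁻¹ • (j' * j') with hm
  have hm0 : 0 ≤ m := by
    have h1 : 0 ≤ j' * j' := by
      have := star_mul_self_nonneg j'
      rwa [hsj] at this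
    exact smul_nonneg (by positivity) h1
  have hneg : -j' ≤ algebraMap ℝ B δ + m := by
    have h1 : 0 ≤ (j' + (2 * δ) • (1 : B)) * (j' + (2 * δ) • (1 : B)) := by
      have := star_mul_self_nonneg (j' + (2 * δ) • (1 : B))
      rwa [star_add, hsj, star_smul, star_one, star_trivial] at this
    have h2 : 0 ≤ (4 * δ)⁻¹ • ((j' + (2 * δ) • (1 : B)) * (j' + (2 * δ) • (1 : B))) :=
      smul_nonneg (by positivity) h1
    rw [← sub_nonneg]
    convert h2 using 1
    rw [hm, Algebra.algebraMap_eq_smul_one]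
    simp only [add_mul, mul_add, smul_mul_assoc, mul_smul_comm, one_mul, mul_one, smul_add,
      smul_smul]
    have e1 : (4 * δ)⁻¹ * (2 * δ) = 2⁻¹ := by field_simp; norm_num
    have e2 : (4 * δ)⁻¹ * (2 * δ * (2 * δ)) = δ := by field_simp; norm_num
    have e3 : j' = (2⁻¹ : ℝ) • j' + (2⁻¹ : ℝ) • j' := by
      rw [← two_smul ℝ, smul_smul]; norm_num
    rw [mul_assoc] at *
    rw [e1, e2, sub_neg_eq_add]
    nth_rewrite 3 [e3]
    abel
  have hmain : star x * x ≤ algebraMap ℝ B (c + δ) + m := by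
    have h1 := add_le_add hle hneg
    rw [add_neg_cancel_right] at h1
    rw [map_add, add_assoc]
    exact h1
  obtain ⟨r, h1, h2, h3⟩ := exists_cutoff hm0 hδ0
  refine ⟨x * (m * r), ?_, ?_⟩
  · refine I.mul_mem_left _ (I.mul_mem_right _ ?_)
    have h4 : m = ((4 * δ)⁻¹ • j') * j' :=
      hm.trans (smul_mul_assoc _ _ _).symm
    rw [h4]
    exact I.mul_mem_left _ hmem
  · have e : x - x * (m * r) = x * (1 - m * r) := by rw [mul_sub, mul_one]
    rw [e]
    set d : B := 1 - m * r with hd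
    have h5 : star d * (star x * x) * d ≤ star d * (algebraMap ℝ B (c + δ) + m) * d :=
      star_left_conjugate_le_conjugate hmain d
    have h6 : 0 ≤ star d * (star x * x) * d := by
      have := star_mul_self_nonneg (x * d)
      rwa [star_mul, mul_assoc, ← mul_assoc (star x), ← mul_assoc] at this
    have hc0 : 0 ≤ c := norm_nonneg _
    calc ‖x * d‖ ^ 2 = ‖star d * (star x * x) * d‖ := by
          rw [sq, ← CStarRing.norm_star_mul_self, star_mul, mul_assoc, ← mul_assoc (star x),
            ← mul_assoc]
      _ ≤ ‖star d * (algebraMap ℝ B (c + δ) + m) * d‖ :=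
          CStarAlgebra.norm_le_norm_of_nonneg_of_le h6 h5
      _ = ‖(c + δ) • (star d * d) + star d * m * d‖ := by
          rw [mul_add, add_mul, Algebra.algebraMap_eq_smul_one, mul_smul_comm, mul_one,
            smul_mul_assoc]
      _ ≤ ‖(c + δ) • (star d * d)‖ + ‖star d * m * d‖ := norm_add_le _ _
      _ ≤ (c + δ) * 1 + δ := by
          refine add_le_add ?_ ?_
          · rw [norm_smul, Real.norm_of_nonneg (by positivity)]
            refine mul_le_mul_of_nonneg_left ?_ (by positivity)
            rw [CStarRing.norm_star_mul_self]
            nlinarith [norm_nonneg d]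
          · rw [h1.star_eq]; exact h3
      _ = c + ε := by rw [hδ]; ring

/-- The quotient `C*`-algebra `B / I`, for `I` a closed two-sided ideal of `B`, with the quotient
norm. -/
def CStarQuotient (I : Ideal B) : Type u := B ⧸ I

namespace CStarQuotient

instance : Ring (CStarQuotient I) := inferInstanceAs (Ring (B ⧸ I))
instance : Algebra ℂ (CStarQuotient I) := inferInstanceAs (Algebra ℂ (B ⧸ I))
instance : NormedAddCommGroup (CStarQuotient I) := inferInstanceAs (NormedAddCommGroup (B ⧸ I))
instance : CompleteSpace (CStarQuotient I) := inferInstanceAs (CompleteSpace (B ⧸ I))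

/-- The quotient map, as an algebra homomorphism. -/
def mkAlg : B →ₐ[ℂ] CStarQuotient I := Ideal.Quotient.mkₐ ℂ I

theorem mkAlg_surjective : Function.Surjective (mkAlg I) := Ideal.Quotient.mkₐ_surjective ℂ I

theorem mkAlg_eq_zero {x : B} : mkAlg I x = 0 ↔ x ∈ I := Ideal.Quotient.eq_zero_iff_mem

theorem norm_mkAlg_le (x : B) : ‖mkAlg I x‖ ≤ ‖x‖ := Submodule.Quotient.norm_mk_le I x

theorem exists_norm_lt (x : CStarQuotient I) {ε : ℝ} (hε : 0 < ε) :
    ∃ b, mkAlg I b = x ∧ ‖b‖ < ‖x‖ + ε := Submodule.Quotient.norm_mk_lt (S := I) x hε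

instance : NormedRing (CStarQuotient I) :=
  { (inferInstance : Ring (CStarQuotient I)),
    (inferInstance : NormedAddCommGroup (CStarQuotient I)) with
    norm_mul_le := fun x y => by
      have key : ∀ ε : ℝ, 0 < ε → ‖x * y‖ ≤ (‖x‖ + ε) * (‖y‖ + ε) := by
        intro ε hε
        obtain ⟨a, rfl, ha⟩ := exists_norm_lt I x hε
        obtain ⟨b, rfl, hb⟩ := exists_norm_lt I y hε
        rw [← map_mul]
        exact (norm_mkAlg_le I _).trans ((norm_mul_le a b).trans
          (mul_le_mul ha.le hb.le (norm_nonneg b) ((norm_nonneg a).trans ha.le)))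
      have hlim : Filter.Tendsto (fun ε : ℝ => (‖x‖ + ε) * (‖y‖ + ε))
          (nhdsWithin 0 (Set.Ioi 0)) (nhds ((‖x‖ + 0) * (‖y‖ + 0))) :=
        (Continuous.tendsto (by fun_prop) 0).mono_left nhdsWithin_le_nhds
      rw [add_zero, add_zero] at hlim
      exact ge_of_tendsto hlim (Filter.eventually_of_mem self_mem_nhdsWithin key) }

instance : NormedAlgebra ℂ (CStarQuotient I) :=
  { (inferInstance : Algebra ℂ (CStarQuotient I)) with
    norm_smul_le := fun c x => by
      refine le_of_forall_pos_le_add fun ε hε => ?_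
      have h0 : 0 < ‖c‖ + 1 := by positivity
      obtain ⟨a, rfl, ha⟩ := exists_norm_lt I x (div_pos hε h0)
      rw [← map_smul]
      refine (norm_mkAlg_le I _).trans ((norm_smul_le c a).trans ?_)
      have h1 : ‖c‖ * ‖a‖ ≤ ‖c‖ * (‖mkAlg I a‖ + ε / (‖c‖ + 1)) :=
        mul_le_mul_of_nonneg_left ha.le (norm_nonneg c)
      have h2 : ‖c‖ * (ε / (‖c‖ + 1)) ≤ ε := by
        rw [mul_div_assoc', div_le_iff₀ h0]
        nlinarith [norm_nonneg c]
      linarith }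

instance : Star (CStarQuotient I) :=
  ⟨Quotient.lift (fun b => mkAlg I (star b)) fun a b h => by
    have h1 : a - b ∈ I := (Submodule.quotientRel_def I).mp h
    rw [← sub_eq_zero, ← map_sub, ← star_sub, mkAlg_eq_zero]
    exact star_mem_of_closed I h1⟩

theorem star_mkAlg (b : B) : star (mkAlg I b) = mkAlg I (star b) := rfl

instance : StarRing (CStarQuotient I) where
  star_involutive x := by
    obtain ⟨a, rfl⟩ := mkAlg_surjective I x
    rw [star_mkAlg, star_mkAlg, star_star]
  star_mul x y := by
    obtain ⟨a, rfl⟩ := mkAlg_surjective I x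
    obtain ⟨b, rfl⟩ := mkAlg_surjective I y
    rw [← map_mul, star_mkAlg, star_mkAlg, star_mkAlg, star_mul, map_mul]
  star_add x y := by
    obtain ⟨a, rfl⟩ := mkAlg_surjective I x
    obtain ⟨b, rfl⟩ := mkAlg_surjective I y
    rw [← map_add, star_mkAlg, star_mkAlg, star_mkAlg, star_add, map_add]

instance : StarModule ℂ (CStarQuotient I) where
  star_smul c x := by
    obtain ⟨a, rfl⟩ := mkAlg_surjective I x
    rw [← map_smul, star_mkAlg, star_mkAlg, star_smul, map_smul]

instance : CStarRing (CStarQuotient I) where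
  norm_mul_self_le x := by
    obtain ⟨a, rfl⟩ := mkAlg_surjective I x
    rw [star_mkAlg, ← map_mul, ← sq]
    refine le_of_forall_pos_le_add fun ε hε => ?_
    obtain ⟨b, hb, hlt⟩ := exists_norm_lt I (mkAlg I (star a * a)) (half_pos hε)
    have hj : b - star a * a ∈ I := by
      rw [← mkAlg_eq_zero, map_sub, hb, sub_self]
    obtain ⟨k, hk, hle⟩ := exists_norm_sq_le I a _ hj (half_pos hε)
    rw [add_sub_cancel] at hle
    have h1 : mkAlg I a = mkAlg I (a - k) := by
      rw [map_sub, (mkAlg_eq_zero I).mpr hk, sub_zero]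
    have h2 : ‖mkAlg I a‖ ^ 2 ≤ ‖a - k‖ ^ 2 := by
      rw [h1]
      exact pow_le_pow_left₀ (norm_nonneg _) (norm_mkAlg_le I _) 2
    linarith

instance : CStarAlgebra (CStarQuotient I) where

/-- The quotient map `B → B / I`. -/
def mk : B →⋆ₐ[ℂ] CStarQuotient I :=
  { mkAlg I with map_star' := fun b => (star_mkAlg I b).symm }

theorem mk_eq_zero {x : B} : mk I x = 0 ↔ x ∈ I := mkAlg_eq_zero I

theorem mk_surjective : Function.Surjective (mk I) := mkAlg_surjective I

end CStarQuotient

end Quotient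

/-! ### Redundancies and the crossed product -/

section CrossedProduct

open HilbertBimodule ToeplitzAlgebra

variable {A : Type u} [CStarAlgebra A] [PartialOrder A] [StarOrderedRing A]
  {α : A →⋆ₙₐ[ℂ] A} (L : TransferOperator α)

/-- The Toeplitz representation `(ψ_S, i_A)` of `M_L` in `𝒯(A, α, L)`. -/
def toeplitzRepS : ToeplitzRep A (ExelModule L) (ToeplitzAlgebra L) :=
  (universalRep L).toToeplitzRep

/-- A redundancy: a pair `(x, k)` where `x = i_A(a)` for some `a`, `k` lies in the closed linear
span of `i_A(A) S S* i_A(A)`, and `x i_A(b) S = k i_A(b) S` for all `b` in `A`. -/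
def IsRedundancy (x k : ToeplitzAlgebra L) : Prop :=
  (∃ a : A, x = iA L a) ∧
  k ∈ (Submodule.span ℂ {z | ∃ b c : A,
    z = iA L b * S L * star (S L) * iA L c}).topologicalClosure ∧
  ∀ b : A, x * iA L b * S L = k * iA L b * S L

/-- The closed linear span of `A α(A) A`. -/
def idealSpan (α : A →⋆ₙₐ[ℂ] A) : Submodule ℂ A :=
  (Submodule.span ℂ {z | ∃ a b c : A, z = a * α b * c}).topologicalClosure

/-- The closed ideal of `𝒯(A, α, L)` generated by the elements `i_A(a) - k`, for all redundancies
`(i_A(a), k)` with `a` in the closed linear span of `A α(A) A`. -/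
def redundancyIdeal : Ideal (ToeplitzAlgebra L) :=
  closedIdeal {z | ∃ (a : A) (k : ToeplitzAlgebra L),
    IsRedundancy L (iA L a) k ∧ a ∈ idealSpan α ∧ z = iA L a - k}

instance : (redundancyIdeal L).IsTwoSided := inferInstanceAs (closedIdeal _).IsTwoSided
instance : IsClosed (redundancyIdeal L : Set (ToeplitzAlgebra L)) :=
  by unfold redundancyIdeal; infer_instance

/-- Exel's crossed product `A ⋊_{α,L} ℕ`. -/
abbrev CrossedProduct : Type u := CStarQuotient (redundancyIdeal L)

/-- The ideal `K_α`: the intersection of the closed linear span of `A α(A) A` with `J(M_L)`. -/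
def Kα : Set A := {a | a ∈ idealSpan α ∧ a ∈ J A (ExelModule L)}

/-- The closed ideal `I(A, α, L)` of `𝒯(A, α, L)` generated by the elements
`i_A(a) - (ψ_S, i_A)^{(1)}(φ(a))` with `a` in `K_α`. -/
def idealI : Ideal (ToeplitzAlgebra L) :=
  closedIdeal {z | ∃ (a : A) (h : a ∈ Kα L),
    z = iA L a - (toeplitzRepS L).compactMap ⟨φ a, h.2⟩}

instance : (idealI L).IsTwoSided := inferInstanceAs (closedIdeal _).IsTwoSided
instance : IsClosed (idealI L : Set (ToeplitzAlgebra L)) :=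
  by unfold idealI; infer_instance

end CrossedProduct

end

noncomputable section

open UniformSpace

universe u v w

set_option linter.unusedSectionVars false

/-! ### Positive functionals -/

section States
open scoped ComplexOrder
variable {A : Type u} [CStarAlgebra A] [PartialOrder A] [StarOrderedRing A]

/-! Everything rests on the injectivity of `iA`. Granted that, `iA` is isometric, and the identity
`star (ψ x) * ψ y = iA ⟨x, y⟩` makes `ψ_S` isometric as well. Since `(ψ_S, i_A)^{(1)}(T) ψ_S(z) =
ψ_S(T z)`, the map `(ψ_S, i_A)^{(1)}` cannot decrease norms, so its range is closed
(`ToeplitzRep.isClosed_range_compactMap`). The range contains the products `i_A(b) S S* i_A(c)`,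
hence their closed span (`exists_compactMap_eq`).

Let `(i_A(a), k)` be a redundancy. Then `k = (ψ_S, i_A)^{(1)}(T)` for a compact `T`, and the
condition on `k` reads `ψ_S(T q(b)) = ψ_S(φ(a) q(b))` for all `b`. Injectivity of `ψ_S` and density
of `q(A)` give `T = φ(a)`, so `a ∈ J(M_L)` and `k` is the asserted element. The converse is the same
multiplication formula read backwards (`isRedundancy_iff`). The two ideals are then generated by
literally the same set, which settles (2).

For injectivity of `iA`, let `a ≠ 0` and choose a positive functional `f` with `f(a* a) ≠ 0`
(`exists_positiveFunctional`). With `s = fockScale L`, the formula `F(x) = ∑ₙ s⁻²ⁿ f(Lⁿ(xₙ))`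
defines a positive functional on bounded sequences in `A`. On its GNS space let `A` act by left
multiplication with constant sequences, and let `V` send `(x₀, x₁, …)` to `(0, s α(x₀), s α(x₁),
…)`. Multiplicativity of `α` gives `V ρ(c) = ρ(α(c)) V`, and the identity `L(α(x) c α(y)) = x L(c)
y` gives `V* ρ(c) V = ρ(L(c))` (`fockFunctional_shift`). So `(ρ, V)` is Toeplitz-covariant and `ρ`
factors through `iA`. Finally `ρ(a) ≠ 0`, because the term of index 0 in `F(a* a)` is `f(a* a)`. -/

theorem exists_realFunctional_neg_lt {x : A} (hx : ¬ 0 ≤ x) :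
    ∃ g : A →L[ℝ] ℝ, (∀ a, 0 ≤ a → 0 ≤ g a) ∧ g x < 0 := by
  have hconv : Convex ℝ {a : A | 0 ≤ a} := convex_Ici (𝕜 := ℝ) (0 : A)
  obtain ⟨g, u, h1, h2⟩ := geometric_hahn_banach_point_closed hconv
    (CStarAlgebra.isClosed_nonneg (A := A)) hx
  -- The cone contains 0, which forces the separating level to be negative.
  have hu : u < 0 := by simpa using h2 0 (le_refl (0 : A))
  refine ⟨g, fun a ha => ?_, h1.trans hu⟩
  by_contra! hneg
  -- The ray through `a` stays in the cone; this multiple of `a` is where `g` takes the value `u`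
  -- exactly, against strict separation.
  have h3 := h2 ((u / g a) • a) (smul_nonneg (div_nonneg_of_nonpos hu.le hneg.le) ha)
  rw [map_smul, smul_eq_mul, div_mul_cancel₀ _ hneg.ne] at h3
  exact lt_irrefl _ h3

/-- Separate `-(a* a)` from the positive cone by a real functional `g`, then complexify. Positivity
of `g` says nothing about its values on skew-adjoint elements, so `g` is symmetrised under `star`
first; the complex extension then takes the real value `2 g(b)` at each positive `b`. -/
theorem exists_positiveFunctional {a : A} (ha : a ≠ 0) :
    ∃ f : A →L[ℂ] ℂ, (∀ b, 0 ≤ b → 0 ≤ f b) ∧ f (star a * a) ≠ 0 := by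
  have hneg : ¬ 0 ≤ -(star a * a) := fun h => ha <| by
    rw [← CStarRing.star_mul_self_eq_zero_iff]
    exact le_antisymm (neg_nonneg.mp h) (star_mul_self_nonneg a)
  obtain ⟨g, hg, hga⟩ := exists_realFunctional_neg_lt hneg
  set h : A →L[ℝ] ℝ := g + g ∘L ((starL' ℝ : A ≃L[ℝ] A) : A →L[ℝ] A) with hh
  have hh' : ∀ b, h b = g b + g (star b) := fun b => rfl
  have hf : ∀ b, 0 ≤ b → (StrongDual.extendRCLike (𝕜 := ℂ) h) b = ((2 * g b : ℝ) : ℂ) := fun b hb => by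
    -- `I • b` is skew-adjoint when `b ≥ 0`, so the symmetrised functional vanishes on it and the
    -- imaginary part of the extension disappears.
    have e : star (Complex.I • b) = -(Complex.I • b) := by
      rw [star_smul, (IsSelfAdjoint.of_nonneg hb).star_eq]
      simp
    rw [StrongDual.extendRCLike_apply, hh', hh', (IsSelfAdjoint.of_nonneg hb).star_eq]
    change ((g b + g b : ℝ) : ℂ) -
      Complex.I * ((g (Complex.I • b) + g (star (Complex.I • b)) : ℝ) : ℂ) = _
    rw [e, map_neg, add_neg_cancel, two_mul]
    simp
  refine ⟨StrongDual.extendRCLike (𝕜 := ℂ) h, fun b hb => ?_, ?_⟩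
  · rw [hf b hb]
    exact_mod_cast mul_nonneg zero_le_two (hg b hb)
  · rw [hf _ (star_mul_self_nonneg a)]
    rw [map_neg] at hga
    exact_mod_cast (by linarith : (0 : ℝ) < 2 * g (star a * a)).ne'

end States

/-! ### Isometry of Toeplitz representations with injective coefficient map -/

section Isometric

open HilbertBimodule

namespace ToeplitzRep

variable {A : Type u} [CStarAlgebra A] [PartialOrder A] [StarOrderedRing A]
  {X : Type v} [NormedAddCommGroup X] [NormedSpace ℂ X] [Module Aᵐᵒᵖ X] [IsScalarTower ℂ Aᵐᵒᵖ X]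
  [HilbertBimodule A X] {B : Type w} [CStarAlgebra B] (r : ToeplitzRep A X B)

theorem continuous_ψ : Continuous r.ψ :=
  AddMonoidHomClass.continuous_of_bound r.ψ 1 fun x => by rw [one_mul]; exact r.norm_ψ_le x

theorem compactMap_toCompacts (v : X × X →₀ ℂ) :
    r.compactMap (toCompacts A X v) = r.rankOneSum v :=
  extendSubmodule_eq (compacts A X) r.rankOneSum (toCompacts A X)
    denseRange_toCompacts r.norm_rankOneSum_le v

/-- Known for finite sums of rank-one operators (`rankOneSum_mul_ψ`); both sides are continuous in
`T`, and those sums are dense in the compacts. This formula is what translates redundancies into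
statements about operators on `X`. -/
theorem compactMap_mul_ψ (T : compacts A X) (z : X) :
    r.compactMap T * r.ψ z = r.ψ ((T : X →L[ℂ] X) z) := by
  refine denseRange_toCompacts.induction_on
    (p := fun T : compacts A X => r.compactMap T * r.ψ z = r.ψ ((T : X →L[ℂ] X) z)) T ?_ fun v => ?_
  · exact isClosed_eq (r.compactMap.continuous.mul continuous_const)
      (r.continuous_ψ.comp ((ContinuousLinearMap.apply ℂ X z).continuous.comp
        continuous_subtype_val))
  · rw [compactMap_toCompacts, rankOneSum_mul_ψ]

theorem compactMap_mem {M : Submodule ℂ B} (hM : IsClosed (M : Set B))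
    (h : ∀ x y, r.ψ x * star (r.ψ y) ∈ M) (T : compacts A X) : r.compactMap T ∈ M := by
  refine denseRange_toCompacts.induction_on (p := fun T => r.compactMap T ∈ M) T
    (hM.preimage r.compactMap.continuous) fun v => ?_
  rw [compactMap_toCompacts, rankOneSum, Finsupp.linearCombination_apply]
  exact Submodule.sum_mem _ fun p _ => M.smul_mem _ (h p.1 p.2)

variable {r}

/-- An injective `*`-homomorphism of `C*`-algebras is isometric, and `‖ψ x‖² = ‖π ⟨x, x⟩‖` by the
`C*`-identity. -/
theorem norm_ψ (hr : Function.Injective r.π) (x : X) : ‖r.ψ x‖ = ‖x‖ := by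
  refine (pow_left_inj₀ (norm_nonneg _) (norm_nonneg _) two_ne_zero).mp ?_
  rw [sq, ← CStarRing.norm_star_mul_self, r.map_ip, norm_sq_eq (A := A),
    NonUnitalStarAlgHom.norm_map r.π hr]

/-- `compactMap T` acts on the isometric copy of `X` inside `B` as `T` does on `X`, so its norm is
at least the operator norm of `T`. Only this lower bound is needed for closed range. -/
theorem norm_le_norm_compactMap (hr : Function.Injective r.π) (T : compacts A X) :
    ‖T‖ ≤ ‖r.compactMap T‖ := by
  refine (T : X →L[ℂ] X).opNorm_le_bound (norm_nonneg _) fun z => ?_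
  rw [← norm_ψ hr, ← compactMap_mul_ψ, ← norm_ψ hr z]
  exact norm_mul_le _ _

/-- Completeness of `X` makes the compacts a closed subspace of a complete space; a map bounded
below on a complete space has closed range. -/
theorem isClosed_range_compactMap [CompleteSpace X] (hr : Function.Injective r.π) :
    IsClosed (Set.range r.compactMap) := by
  have : CompleteSpace (compacts A X) :=
    (Submodule.isClosed_topologicalClosure _).completeSpace_coe
  exact AntilipschitzWith.isClosed_range (K := 1)
    (r.compactMap.antilipschitz_of_bound fun T => by
      rw [NNReal.coe_one, one_mul]; exact norm_le_norm_compactMap hr T)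
    r.compactMap.uniformContinuous

end ToeplitzRep

end Isometric

/-! ### Redundancies -/

section Redundancy

open HilbertBimodule ToeplitzAlgebra

variable {A : Type u} [CStarAlgebra A] [PartialOrder A] [StarOrderedRing A]
  {α : A →⋆ₙₐ[ℂ] A} (L : TransferOperator α)

/-- The closed linear span of `i_A(A) S S* i_A(A)`. -/
def redundancySpan : Submodule ℂ (ToeplitzAlgebra L) :=
  (Submodule.span ℂ {z | ∃ b c : A,
    z = iA L b * S L * star (S L) * iA L c}).topologicalClosure

theorem toeplitzRepS_ψ_q (a : A) : (toeplitzRepS L).ψ (ExelModule.q L a) = iA L a * S L :=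
  (universalRep L).ψ_q a

theorem toeplitzRepS_ψ_mul_star_ψ_q (b c : A) :
    (toeplitzRepS L).ψ (ExelModule.q L b) * star ((toeplitzRepS L).ψ (ExelModule.q L c)) =
      iA L b * S L * star (S L) * iA L (star c) := by
  rw [toeplitzRepS_ψ_q, toeplitzRepS_ψ_q, star_mul, ← StarHomClass.map_star, mul_assoc, mul_assoc,
    mul_assoc]

/-- By continuity of `ψ` it is enough to look at `x = q(b)`, `y = q(c)`, where `ψ(x) ψ(y)*` is one
of the spanning products. -/
theorem compactMap_mem_redundancySpan (T : compacts A (ExelModule L)) :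
    (toeplitzRepS L).compactMap T ∈ redundancySpan L := by
  have hcl : IsClosed (redundancySpan L : Set (ToeplitzAlgebra L)) :=
    Submodule.isClosed_topologicalClosure _
  have hψ := (toeplitzRepS L).continuous_ψ
  refine (toeplitzRepS L).compactMap_mem hcl (fun x y => ?_) T
  refine ExelModule.induction₂ L (P := fun x y =>
    (toeplitzRepS L).ψ x * star ((toeplitzRepS L).ψ y) ∈ redundancySpan L) x y
    (hcl.preimage ((hψ.comp continuous_fst).mul (hψ.comp continuous_snd).star)) fun b c => ?_
  rw [toeplitzRepS_ψ_mul_star_ψ_q]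
  exact Submodule.le_topologicalClosure _ (Submodule.subset_span ⟨b, star c, rfl⟩)

variable {L}

/-- The range is a closed subspace containing the spanning products, so it contains their closed
span. Injectivity of `iA` enters through the closedness. -/
theorem exists_compactMap_eq (hL : Function.Injective (iA L)) {k : ToeplitzAlgebra L}
    (hk : k ∈ redundancySpan L) : ∃ T, (toeplitzRepS L).compactMap T = k := by
  have hle : redundancySpan L ≤ LinearMap.range (toeplitzRepS L).compactMap.toLinearMap := by
    refine Submodule.topologicalClosure_minimal _ (Submodule.span_le.mpr ?_) ?_
    · rintro _ ⟨b, c, rfl⟩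
      -- The second vector enters the rank-one image through an adjoint, hence `star c`.
      refine ⟨⟨_, Θ_mem_compacts (ExelModule.q L b) (ExelModule.q L (star c))⟩, ?_⟩
      have h := (toeplitzRepS L).compactMap_Θ (ExelModule.q L b) (ExelModule.q L (star c))
      rw [toeplitzRepS_ψ_mul_star_ψ_q, star_star] at h
      exact h
    · exact ToeplitzRep.isClosed_range_compactMap (r := toeplitzRepS L) hL
  exact hle hk

theorem isRedundancy_iff (hL : Function.Injective (iA L)) (a : A) (k : ToeplitzAlgebra L) :
    IsRedundancy L (iA L a) k ↔ ∃ h : a ∈ J A (ExelModule L),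
      k = (toeplitzRepS L).compactMap ⟨φ a, h⟩ := by
  constructor
  · rintro ⟨-, hk, hmul⟩
    obtain ⟨T, rfl⟩ := exists_compactMap_eq hL hk
    have hT : (T : ExelModule L →L[ℂ] ExelModule L) = φ a := by
      refine ExelModule.ext_q L fun b => ?_
      -- Isometry of `ψ` lets both vectors be compared after applying `ψ`, where the equality is the
      -- redundancy condition for `b`.
      rw [← sub_eq_zero, ← norm_eq_zero, ← ToeplitzRep.norm_ψ (r := toeplitzRepS L) hL, norm_eq_zero,
        map_sub, sub_eq_zero, ← ToeplitzRep.compactMap_mul_ψ, ExelModule.φ_q, toeplitzRepS_ψ_q,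
        toeplitzRepS_ψ_q, ← mul_assoc, ← hmul b, map_mul]
    have h : a ∈ J A (ExelModule L) := by
      change (φ a : ExelModule L →L[ℂ] ExelModule L) ∈ compacts A (ExelModule L)
      rw [← hT]; exact T.2
    exact ⟨h, congrArg _ (Subtype.ext hT)⟩
  · rintro ⟨h, rfl⟩
    refine ⟨⟨a, rfl⟩, compactMap_mem_redundancySpan L _, fun b => ?_⟩
    have hmul := (toeplitzRepS L).compactMap_mul_ψ ⟨φ a, h⟩ (ExelModule.q L b)
    rw [ExelModule.φ_q, toeplitzRepS_ψ_q, toeplitzRepS_ψ_q, map_mul, ← mul_assoc] at hmul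
    exact hmul.symm

/-- By `isRedundancy_iff` the generating sets already agree; no argument about ideals is required.
-/
theorem redundancyIdeal_eq_idealI (hL : Function.Injective (iA L)) :
    redundancyIdeal L = idealI L := by
  refine congrArg closedIdeal (Set.ext fun z => ⟨?_, ?_⟩)
  · rintro ⟨a, k, hk, ha, rfl⟩
    obtain ⟨hJ, rfl⟩ := (isRedundancy_iff hL a k).mp hk
    exact ⟨a, ⟨ha, hJ⟩, rfl⟩
  · rintro ⟨a, h, rfl⟩
    exact ⟨a, _, (isRedundancy_iff hL a _).mpr ⟨h.2, rfl⟩, h.1, rfl⟩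

end Redundancy

/-- Stated for variable ideals so that the equality can be substituted: the quotient types and their
structures then coincide and the identity serves. -/
theorem CStarQuotient.exists_starAlgEquiv_of_eq {B : Type u} [CStarAlgebra B] {I I' : Ideal B}
    [I.IsTwoSided] [IsClosed (I : Set B)] [I'.IsTwoSided] [IsClosed (I' : Set B)] (h : I = I') :
    ∃ θ : CStarQuotient I ≃⋆ₐ[ℂ] CStarQuotient I', ∀ x, θ (mk I x) = mk I' x := by
  subst h
  exact ⟨StarAlgEquiv.refl ℂ _, fun _ => rfl⟩

/-! ### The Fock representation -/

section Fock

open scoped ComplexOrder BoundedContinuousFunction InnerProductSpace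
open BoundedContinuousFunction

variable {A : Type u} [CStarAlgebra A] [PartialOrder A] [StarOrderedRing A]

/-- The order on bounded sequences is needed to speak of positive functionals on them. Its only
comparison with the given order of `A` is `seq_apply_nonneg`, which holds because evaluations are
`*`-homomorphisms and hence monotone. -/
instance : PartialOrder (ℕ →ᵇ A) := CStarAlgebra.spectralOrder _
instance : StarOrderedRing (ℕ →ᵇ A) := CStarAlgebra.spectralOrderedRing _

/-- Evaluation at a point, as a `*`-homomorphism on bounded sequences. -/
def seqEval (n : ℕ) : (ℕ →ᵇ A) →⋆ₙₐ[ℂ] A where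
  toFun a := a n
  map_smul' _ _ := rfl
  map_zero' := rfl
  map_add' _ _ := rfl
  map_mul' _ _ := rfl
  map_star' _ := rfl

theorem seq_apply_nonneg {a : ℕ →ᵇ A} (ha : 0 ≤ a) (n : ℕ) : 0 ≤ a n := by
  have h := OrderHomClass.mono (seqEval (A := A) n) ha
  rwa [map_zero] at h

/-- The constant sequences. -/
def seqConst : A →⋆ₐ[ℂ] (ℕ →ᵇ A) where
  toFun a := const ℕ a
  map_one' := rfl
  map_mul' _ _ := rfl
  map_zero' := rfl
  map_add' _ _ := rfl
  commutes' _ := rfl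
  map_star' _ := rfl

theorem seqConst_apply (a : A) (n : ℕ) : seqConst a n = a := rfl

/-! ### Weighted functionals and the scaled shift on bounded sequences. -/

variable {α : A →⋆ₙₐ[ℂ] A} (L : TransferOperator α)

/-- A scaling factor whose square dominates `2 ‖L‖`. -/
def fockScale : ℝ := ‖L.toCLM‖ + 1

theorem fockScale_pos : 0 < fockScale L := by unfold fockScale; positivity

/-- The functionals `f ∘ Lⁿ`, rescaled so as to be summable. -/
def fockWeight (f : A →L[ℂ] ℂ) : ℕ → (A →L[ℂ] ℂ)
  | 0 => f
  | n + 1 => ((fockScale L ^ 2)⁻¹ : ℝ) • (fockWeight f n).comp L.toCLM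

theorem fockWeight_succ_apply (f : A →L[ℂ] ℂ) (n : ℕ) (a : A) :
    fockWeight L f (n + 1) a = ((fockScale L ^ 2)⁻¹ : ℝ) • fockWeight L f n (L a) := rfl

theorem fockWeight_nonneg {f : A →L[ℂ] ℂ} (hf : ∀ a, 0 ≤ a → 0 ≤ f a) (n : ℕ) {a : A}
    (ha : 0 ≤ a) : 0 ≤ fockWeight L f n a := by
  induction n generalizing a with
  | zero => exact hf a ha
  | succ n ih =>
    rw [fockWeight_succ_apply]
    have h : 0 ≤ (fockScale L ^ 2)⁻¹ := by positivity
    exact smul_nonneg h (ih (L.nonneg' a ha))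

theorem norm_fockWeight_le (f : A →L[ℂ] ℂ) (n : ℕ) : ‖fockWeight L f n‖ ≤ ‖f‖ * (1 / 2) ^ n := by
  induction n with
  | zero => simp [fockWeight]
  | succ n ih =>
    have h0 := fockScale_pos L
    -- This is `2 t ≤ (t + 1)²` with `t = ‖L‖`; each further application of `L` therefore costs at
    -- most a factor 1/2, whatever the norm of `L`.
    have h1 : (fockScale L ^ 2)⁻¹ * ‖L.toCLM‖ ≤ 1 / 2 := by
      rw [inv_mul_le_iff₀ (by positivity), fockScale]
      nlinarith [norm_nonneg L.toCLM]
    rw [fockWeight, norm_smul, Real.norm_of_nonneg (by positivity)]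
    calc (fockScale L ^ 2)⁻¹ * ‖(fockWeight L f n).comp L.toCLM‖
        ≤ (fockScale L ^ 2)⁻¹ * (‖fockWeight L f n‖ * ‖L.toCLM‖) := by
          gcongr; exact ContinuousLinearMap.opNorm_comp_le _ _
      _ = ‖fockWeight L f n‖ * ((fockScale L ^ 2)⁻¹ * ‖L.toCLM‖) := by ring
      _ ≤ (‖f‖ * (1 / 2) ^ n) * (1 / 2) := by gcongr
      _ = ‖f‖ * (1 / 2) ^ (n + 1) := by ring

theorem summable_fockWeight (f : A →L[ℂ] ℂ) (a : ℕ →ᵇ A) :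
    Summable fun n => fockWeight L f n (a n) := by
  refine Summable.of_norm_bounded (g := fun n => ‖f‖ * ‖a‖ * (1 / 2) ^ n)
    (summable_geometric_two.mul_left _) fun n => ?_
  calc ‖fockWeight L f n (a n)‖ ≤ ‖fockWeight L f n‖ * ‖a n‖ := ContinuousLinearMap.le_opNorm _ _
    _ ≤ (‖f‖ * (1 / 2) ^ n) * ‖a‖ := by
      gcongr
      · exact norm_fockWeight_le L f n
      · exact a.norm_coe_le_norm n
    _ = ‖f‖ * ‖a‖ * (1 / 2) ^ n := by ring

/-- The positive functional `a ↦ ∑ₙ f(Lⁿ(aₙ))`, suitably weighted, on bounded sequences. -/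
def fockFunctional (f : A →L[ℂ] ℂ) (hf : ∀ a, 0 ≤ a → 0 ≤ f a) : (ℕ →ᵇ A) →ₚ[ℂ] ℂ :=
  PositiveLinearMap.mk₀
    { toFun := fun a => ∑' n, fockWeight L f n (a n)
      map_add' := fun a b => by
        rw [← (summable_fockWeight L f a).tsum_add (summable_fockWeight L f b)]
        exact tsum_congr fun n => map_add _ _ _
      map_smul' := fun c a => by
        rw [RingHom.id_apply, ← (summable_fockWeight L f a).tsum_const_smul]
        exact tsum_congr fun n => map_smul _ _ _ }
    fun a ha => tsum_nonneg fun n => fockWeight_nonneg L hf n (seq_apply_nonneg ha n)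

/-- The scaled shift `(a₀, a₁, …) ↦ (0, c α(a₀), c α(a₁), …)`. -/
def fockShift : (ℕ →ᵇ A) →ₗ[ℂ] (ℕ →ᵇ A) where
  toFun a := ofNormedAddCommGroupDiscrete
    -- The factor `fockScale L` occurs twice in an inner product and so cancels the weight
    -- `(fockScale L ^ 2)⁻¹` gained in passing from index `m` to `m + 1`.
    (fun n => Nat.casesOn n 0 fun m => (fockScale L : ℂ) • α (a m)) (fockScale L * ‖a‖) fun n => by
      have h0 := (fockScale_pos L).le
      cases n with
      | zero => exact norm_zero.trans_le (mul_nonneg h0 (norm_nonneg a))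
      | succ m =>
        rw [norm_smul, Complex.norm_real, Real.norm_of_nonneg h0]
        exact mul_le_mul_of_nonneg_left
          ((NonUnitalStarAlgHom.norm_apply_le α _).trans (a.norm_coe_le_norm m)) h0
  map_add' a b := by
    ext n
    cases n with
    | zero => exact (add_zero (0 : A)).symm
    | succ m =>
      change (fockScale L : ℂ) • α (a m + b m) =
        (fockScale L : ℂ) • α (a m) + (fockScale L : ℂ) • α (b m)
      rw [map_add, smul_add]
  map_smul' c a := by
    ext n
    cases n with
    | zero => exact (smul_zero c).symm
    | succ m =>
      change (fockScale L : ℂ) • α (c • a m) = c • (fockScale L : ℂ) • α (a m)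
      rw [map_smul, smul_comm]

theorem fockShift_zero (a : ℕ →ᵇ A) : fockShift L a 0 = 0 := rfl

theorem fockShift_succ (a : ℕ →ᵇ A) (n : ℕ) :
    fockShift L a (n + 1) = (fockScale L : ℂ) • α (a n) := rfl

theorem fockShift_const_mul (c : A) (a : ℕ →ᵇ A) :
    fockShift L (seqConst c * a) = seqConst (α c) * fockShift L a := by
  ext n
  cases n with
  | zero => exact (mul_zero _).symm
  | succ m =>
    rw [mul_apply, fockShift_succ, fockShift_succ, mul_apply, map_mul α, seqConst_apply,
      seqConst_apply, mul_smul_comm]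

variable {f : A →L[ℂ] ℂ} (hf : ∀ a, 0 ≤ a → 0 ≤ f a)

theorem fockFunctional_apply (a : ℕ →ᵇ A) :
    fockFunctional L f hf a = ∑' n, fockWeight L f n (a n) := rfl

/-- This is the relation `V* ρ(c) V = ρ(L(c))` before completion. The term of index `n + 1` on the
left equals the term of index `n` on the right: its extra `L` turns `α(aₙ*) c α(bₙ)` into `aₙ* L(c)
bₙ`, and the scaling factors cancel. -/
theorem fockFunctional_shift (a b : ℕ →ᵇ A) (c : A) :
    fockFunctional L f hf (star (fockShift L a) * (seqConst c * fockShift L b)) =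
      fockFunctional L f hf (star a * (seqConst (L c) * b)) := by
  rw [fockFunctional_apply, fockFunctional_apply,
    -- The term of index 0 is split off because shifted sequences vanish there.
    (summable_fockWeight L f _).tsum_eq_zero_add]
  have h0 : (star (fockShift L a) * (seqConst c * fockShift L b)) 0 = 0 := by
    rw [mul_apply, mul_apply, fockShift_zero, mul_zero, mul_zero]
  rw [h0, map_zero, zero_add]
  refine tsum_congr fun n => ?_
  have h1 : (star (fockShift L a) * (seqConst c * fockShift L b)) (n + 1) =
      ((fockScale L ^ 2 : ℝ) : ℂ) • (α (star (a n)) * (c * α (b n))) := by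
    rw [mul_apply, mul_apply, star_apply, fockShift_succ, fockShift_succ, seqConst_apply,
      star_smul, StarHomClass.map_star, mul_smul_comm, mul_smul_comm, smul_mul_assoc, smul_smul,
      Complex.star_def, Complex.conj_ofReal, ← Complex.ofReal_mul, sq]
  have h2 : (star a * (seqConst (L c) * b)) n = star (a n) * (L c * b n) := rfl
  have h3 : fockScale L ^ 2 ≠ 0 := (pow_pos (fockScale_pos L) 2).ne'
  rw [h1, h2, fockWeight_succ_apply, map_smul L.toCLM, L.map_mul, L.map_mul_right, map_smul,
    ← Complex.coe_smul, smul_smul, ← Complex.ofReal_mul, inv_mul_cancel₀ h3, Complex.ofReal_one,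
    one_smul]

/-! ### The GNS space and the covariant representation on it. -/

/-- The Fock space. -/
abbrev FockSpace : Type u := (fockFunctional L f hf).GNS

/-- The representation of `A` on the Fock space by left multiplication. -/
def fockRho : A →⋆ₐ[ℂ] (FockSpace L hf →L[ℂ] FockSpace L hf) :=
  (fockFunctional L f hf).gnsStarAlgHom.comp seqConst

theorem fockRho_coe (c : A) (x : (fockFunctional L f hf).PreGNS) :
    fockRho L hf c (x : FockSpace L hf) = (((fockFunctional L f hf).toPreGNS
      (seqConst c * (fockFunctional L f hf).ofPreGNS x) :
        (fockFunctional L f hf).PreGNS) : FockSpace L hf) :=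
  PositiveLinearMap.gnsNonUnitalStarAlgHom_apply_coe _

/-- The shift on the space of bounded sequences with the inner product. -/
def preFockV : (fockFunctional L f hf).PreGNS →ₗ[ℂ] (fockFunctional L f hf).PreGNS :=
  (fockFunctional L f hf).toPreGNS.toLinearMap ∘ₗ fockShift L ∘ₗ
    (fockFunctional L f hf).ofPreGNS.toLinearMap

theorem inner_preFockV (c : A) (x y : (fockFunctional L f hf).PreGNS) :
    ⟪((preFockV L hf x : (fockFunctional L f hf).PreGNS) : FockSpace L hf),
      fockRho L hf c (preFockV L hf y : (fockFunctional L f hf).PreGNS)⟫_ℂ =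
    ⟪(x : FockSpace L hf), fockRho L hf (L c) (y : FockSpace L hf)⟫_ℂ := by
  rw [fockRho_coe, fockRho_coe, Completion.inner_coe, Completion.inner_coe]
  exact fockFunctional_shift L hf _ _ c

/-- The bounded operator on the Fock space induced by the shift. -/
def fockV : FockSpace L hf →L[ℂ] FockSpace L hf :=
  ((preFockV L hf).mkContinuous (1 + ‖fockRho L hf (L 1)‖) fun x => by
    refine (pow_le_pow_iff_left₀ (norm_nonneg _) (by positivity) two_ne_zero).mp ?_
    -- At `c = 1` this reads `‖V x‖² = ⟨x, ρ(L 1) x⟩ ≤ t ‖x‖²` with `t = ‖ρ(L 1)‖`. The bound `1 +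
    -- t` avoids a square root, since `t ≤ (1 + t)²`. Boundedness for the seminorm also lets `V`
    -- pass to the Hausdorff completion.
    have h := inner_preFockV L hf 1 x x
    rw [map_one, one_apply_eq_self] at h
    have h1 := norm_inner_le_norm (𝕜 := ℂ) (x : FockSpace L hf)
      (fockRho L hf (L 1) (x : FockSpace L hf))
    rw [← h, inner_self_eq_norm_sq_to_K, norm_pow, RCLike.norm_ofReal, abs_norm,
      Completion.norm_coe, Completion.norm_coe] at h1
    have h2 := (fockRho L hf (L 1)).le_opNorm (x : FockSpace L hf)
    rw [Completion.norm_coe] at h2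
    have h3 := norm_nonneg (fockRho L hf (L 1))
    calc ‖preFockV L hf x‖ ^ 2 ≤ ‖x‖ * (‖fockRho L hf (L 1)‖ * ‖x‖) :=
          h1.trans (mul_le_mul_of_nonneg_left h2 (norm_nonneg x))
      _ = ‖fockRho L hf (L 1)‖ * ‖x‖ ^ 2 := by ring
      _ ≤ (1 + ‖fockRho L hf (L 1)‖) ^ 2 * ‖x‖ ^ 2 :=
          mul_le_mul_of_nonneg_right (by nlinarith) (by positivity)
      _ = _ := (mul_pow _ _ _).symm).completion

theorem fockV_coe (x : (fockFunctional L f hf).PreGNS) :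
    fockV L hf (x : FockSpace L hf) = (preFockV L hf x : (fockFunctional L f hf).PreGNS) :=
  ContinuousLinearMap.completion_apply_coe _ _

/-- The Fock representation of `(A, α, L)` attached to a positive functional on `A`. -/
def fockRep : ToeplitzCovariantRep L (FockSpace L hf →L[ℂ] FockSpace L hf) where
  ρ := fockRho L hf
  V := fockV L hf
  comm a := by
    ext x
    refine Completion.induction_on x (isClosed_eq (by fun_prop) (by fun_prop)) fun x => ?_
    rw [mul_apply_eq_comp, mul_apply_eq_comp, fockRho_coe, fockV_coe,
      fockV_coe, fockRho_coe]
    exact congrArg (fun y : (fockFunctional L f hf).PreGNS => (y : FockSpace L hf))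
      (fockShift_const_mul L a _)
  conj a := by
    -- Pairing with an arbitrary `x` moves the adjoint of `V` onto `x`; on the dense subspace the
    -- claim is then `inner_preFockV`.
    refine ContinuousLinearMap.ext fun y => ext_inner_left ℂ fun x => ?_
    rw [mul_assoc, mul_apply_eq_comp, mul_apply_eq_comp,
      ContinuousLinearMap.star_eq_adjoint, ContinuousLinearMap.adjoint_inner_right]
    refine Completion.induction_on₂ x y (isClosed_eq (by fun_prop) (by fun_prop)) fun x y => ?_
    rw [fockV_coe, fockV_coe, inner_preFockV]

/-- Apply `ρ(a)` to the class of the constant sequence 1: the square of the norm is the value of the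
Fock functional at the constant sequence `a* a`, a series of nonnegative terms beginning with `f(a*
a)`. -/
theorem fockRho_ne_zero {a : A} (ha : f (star a * a) ≠ 0) : fockRho L hf a ≠ 0 := by
  intro h
  have h1 := fockRho_coe L hf a ((fockFunctional L f hf).toPreGNS 1)
  rw [h] at h1
  have h2 := congrArg (fun z => ⟪z, z⟫_ℂ) h1
  simp only [zero_apply, inner_zero_left, Completion.inner_coe] at h2
  have h3 : fockFunctional L f hf (seqConst (star a * a)) = 0 := by
    rw [PositiveLinearMap.preGNS_inner_def] at h2
    rw [map_mul, map_star]
    simpa using h2.symm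
  rw [fockFunctional_apply] at h3
  have hn : ∀ n, 0 ≤ fockWeight L f n (star a * a) := fun n =>
    fockWeight_nonneg L hf n (star_mul_self_nonneg a)
  -- If the sum vanishes, nonnegativity bounds its term of index 0, which is `f(a* a)`, by 0.
  have h4 := (summable_fockWeight L f (seqConst (star a * a))).le_tsum 0 fun n _ => hn n
  rw [h3] at h4
  exact ha (le_antisymm h4 (hn 0))

/-- By the universal property the Fock action of `A` factors through `iA`, so an element killed by
`iA` is killed by every Fock representation; a functional chosen for that element rules this out
unless it is 0. -/
theorem ToeplitzAlgebra.iA_injective : Function.Injective (ToeplitzAlgebra.iA L) := by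
  refine (injective_iff_map_eq_zero _).mpr fun a ha => ?_
  by_contra h0
  obtain ⟨f, hf, hfa⟩ := exists_positiveFunctional h0
  refine fockRho_ne_zero L hf hfa ?_
  have h := ToeplitzAlgebra.lift_iA (fockRep L hf) a
  rw [ha, map_zero] at h
  exact h.symm

end Fock

end

/-! ### The theorem on redundancies and the crossed product. -/

theorem mainTheorem8 {A : Type*} [CStarAlgebra A] [PartialOrder A] [StarOrderedRing A]
    (α : A →⋆ₙₐ[ℂ] A) (L : TransferOperator α) :
    (∀ (a : A) (k : ToeplitzAlgebra L),
      IsRedundancy L (ToeplitzAlgebra.iA L a) k ↔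
        ∃ h : a ∈ HilbertBimodule.J A (ExelModule L),
          k = (toeplitzRepS L).compactMap ⟨HilbertBimodule.φ a, h⟩) ∧
    redundancyIdeal L = idealI L ∧
    ∃ θ : CrossedProduct L ≃⋆ₐ[ℂ] CStarQuotient (idealI L),
      ∀ x : ToeplitzAlgebra L,
        θ (CStarQuotient.mk (redundancyIdeal L) x) = CStarQuotient.mk (idealI L) x :=
  have hL := ToeplitzAlgebra.iA_injective L
  ⟨isRedundancy_iff hL, redundancyIdeal_eq_idealI hL,
    CStarQuotient.exists_starAlgEquiv_of_eq (redundancyIdeal_eq_idealI hL)⟩
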